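/- Let $s\ge 1$, let $i_1>i_2>\dots>i_s>0$ and $m_1,\dots,m_s>0$ be integers, $r=\sum_v m_vi_v$, and let $\lambda\in\mathbb C[x]$. Let $E$ be the trivial bundle of rank $r$ on $B=\mathbb A^1=\operatorname{Spec}\mathbb C[x]$, with frame and homogeneous fibre coordinates $z_{v,k,j}$ indexed by $1\le v\le s$, $1\le k\le m_v$, $1\le j\le i_v$, and let $\phi$ be the Higgs field ($\Omega^1_B=\mathcal O_B\,dx$) whose matrix is in (upper triangular) Jordan form with the single eigenvalue $\lambda$ and, for each $v$, exactly $m_v$ Jordan blocks of size $i_v$; the indices $(v,k,1),\dots,(v,k,i_v)$ belong to the $k$-th block of size $i_v$. Let $\mathrm{Hgrass}_1(E,\phi)\subset\mathbb P(E)$ be the closed subscheme where the composition $S\to E\xrightarrow{\phi}E\otimes\Omega^1_B\to Q\otimes\Omega^1_B$ vanishes ($S$ the universal line subbundle, $Q$ the universal quotient; pullbacks to $\mathbb P(E)$ understood), and let $\rho_1$ be its projection to $B$. For $1\le v\le s$ put $A_{w,k}^{v}=\{(w,k,j): 1\le j\le i_v\}$ for $w\le v$, $1\le k\le m_w$, and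 - $\mathscr L_v$ = the set of indices in none of the sets $A_{w,k}^{v}$; - $\mathscr B_v=\bigcup_{w\le v,\,k}\bigl(A_{w,k}^{v}\setminus\{\min A_{w,k}^{v}\}\bigr)$ and $\mathscr C_v=\{\max A_{w,k}^{v}: w\le v,\ 1\le k\le m_w\}$, i.e. the indices $(w,k,j)$ with $w\le v$ and $2\le j\le i_v$, respectively $j=i_v$; - $M_v$ = the matrix with two rows whose columns are all $\binom{z_{w,k,j}}{z_{w,k,j+1}}$ with $w\le v$, $1\le k\le m_w$, $1\le j<i_v$; - $I_{V_v}=(z_p: p\in\mathscr L_v)+(z_bz_c: b\in\mathscr B_v,\ c\in\mathscr C_v)+(2\times 2\text{ minors of }M_v)\subset\mathbb C[z]$; - $V_v\subset\mathbb P^{r-1}_{\mathbb C}$ the closed subscheme defined by $I_{V_v}$, and $d_v=-1+\sum_{w\le v}m_w$. **Theorem.** Let $b\in\mathbb C$. 1. The fibre $Z_\phi=\rho_1^{-1}(b)$ is the closed subscheme of $\mathbb P(E_b)=\mathbb P^{r-1}_{\mathbb C}$ defined by the homogeneous ideal $I_\phi=\bigl(\sum_k z_k(\phi_{jk}(b)z_i-\phi_{ik}(b)z_j)\bigr)_{i,j}$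 ($i,j,k$ running over all indices). It is the scheme-theoretic union of $V_1,\dots,V_s$, and $I_\phi=\bigcap_{v=1}^sI_{V_v}$ is a minimal (irredundant, with pairwise distinct radicals) primary decomposition with $s$ components. Every $V_v$ is irreducible, and $\sqrt{I_{V_1}}\supsetneq\dots\supsetneq\sqrt{I_{V_s}}$, so that $V_1,\dots,V_{s-1}$ are embedded components. 2. For every $v$ one has $\dim V_v=d_v$, and there is a morphism $\pi\colon V_v\to\mathbb P^{d_v}_{\mathbb C}$ over $\mathbb C$ whose restriction to the reduction $(V_v)_{\mathrm{red}}$ is an isomorphism $(V_v)_{\mathrm{red}}\cong\mathbb P^{d_v}_{\mathbb C}$ and which makes $V_v$ a Zariski locally trivial bundle over $\mathbb P^{d_v}_{\mathbb C}$ whose fibre is the curvilinear fat point $\operatorname{Spec}\mathbb C[t]/(t^{i_v})$ of degree $i_v$. -/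

import Mathlib

open CategoryTheory CategoryTheory.Limits AlgebraicGeometry

noncomputable section

namespace HiggsGrass

attribute [local instance] MvPolynomial.gradedAlgebra

/-! ### Projective space and its closed subschemes -/

section ProjectiveSpace

variable (n : Type) (R : Type) [CommRing R]

/-- The standard grading of `R[z_k | k ∈ n]`. -/
abbrev grading : ℕ → Submodule R (MvPolynomial n R) :=
  MvPolynomial.homogeneousSubmodule n R

/-- The projective space `ℙ(R^n) = Proj R[z_k | k ∈ n]`; its points are the lines in `R^n`
and the `z_k` are the homogeneous coordinates. -/
abbrev PP : Scheme := Proj (grading n R)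

/-- The structure morphism `ℙ(R^n) ⟶ Spec R`. -/
def PP.toSpec : PP n R ⟶ Spec (.of R) :=
  Proj.toSpecZero (grading n R) ≫
    Spec.map (CommRingCat.ofHom (algebraMap R (grading n R 0)))

variable {n R}

lemma X_mem (a : n) : (MvPolynomial.X a : MvPolynomial n R) ∈ grading n R 1 :=
  MvPolynomial.isHomogeneous_X R a

/-- The coordinate ring `R[z_k / z_a | k ∈ n]` of the standard chart `{z_a ≠ 0}` of `ℙ(R^n)`. -/
abbrev ChartRing (n R : Type) [CommRing R] (a : n) : Type :=
  HomogeneousLocalization.Away (grading n R) (MvPolynomial.X a)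

/-- The standard chart `{z_a ≠ 0}` of `ℙ(R^n)`. -/
def chart (a : n) : Spec (.of (ChartRing n R a)) ⟶ PP n R :=
  Proj.awayι (grading n R) (MvPolynomial.X a) (X_mem a) Nat.one_pos

/-- The affine coordinate `z_k / z_a` on the chart `{z_a ≠ 0}`. -/
def coord (a k : n) : ChartRing n R a :=
  HomogeneousLocalization.Away.mk (grading n R) (X_mem a) 1 (MvPolynomial.X k)
    (by simpa using X_mem k)

/-- Constants as functions on the chart `{z_a ≠ 0}`. -/
def const (a : n) : R →+* ChartRing n R a :=
  (HomogeneousLocalization.fromZeroRingHom (grading n R) _).comp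
    (algebraMap R (grading n R 0))

/-- The ideal sheaf on `ℙ(R^n)` which is given on each standard chart `{z_a ≠ 0}` by the ideal
`J a`: a local function belongs to it iff its restriction to each chart lies in `J a`.
(Used for families `J` that agree on the overlaps of the charts.) -/
def sheafOfCharts (J : ∀ a : n, Ideal (ChartRing n R a)) : (PP n R).IdealSheafData :=
  ⨅ a : n, (Spec.map (CommRingCat.ofHom (Ideal.Quotient.mk (J a))) ≫ chart a).ker

/-- The ideal sheaf on `ℙ(R^n)` of a homogeneous ideal `I` of `R[z_k | k ∈ n]`: on the chart
`{z_a ≠ 0}` it consists of the fractions `f / z_a ^ N` with `f ∈ I` homogeneous of degree `N`. -/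
def idealSheaf (I : Ideal (MvPolynomial n R)) : (PP n R).IdealSheafData :=
  sheafOfCharts fun a =>
    (I.map (algebraMap (MvPolynomial n R)
      (Localization.Away (MvPolynomial.X a : MvPolynomial n R)))).comap
      (algebraMap (ChartRing n R a)
        (Localization.Away (MvPolynomial.X a : MvPolynomial n R)))

/-- The closed subscheme `V₊(I)` of `ℙ(R^n)`. -/
abbrev zeroScheme (I : Ideal (MvPolynomial n R)) : Scheme := (idealSheaf I).subscheme

/-- `V₊(I)` as a scheme over `Spec R`. -/
abbrev zeroScheme.toSpec (I : Ideal (MvPolynomial n R)) : zeroScheme I ⟶ Spec (.of R) :=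
  (idealSheaf I).subschemeι ≫ PP.toSpec n R

end ProjectiveSpace

/-! ### The Higgs Grassmannian of rank one subbundles -/

section HiggsGrassmannian

variable {n : Type} [Fintype n] {R : Type} [CommRing R]

/-- The local equations of the Higgs Grassmannian on the chart `{z_a ≠ 0}`. There the universal
line subbundle `S ⊆ 𝒪^n` is spanned by `e = (z_k / z_a)_k`, so that `S ⟶ 𝒪^n ⟶ 𝒪^n ⟶ Q = 𝒪^n / S`
(inclusion, `φ`, projection) is the section `[φ e]` of `Q`. Its zero locus is cut out by the values
on it of all linear forms on `Q`, i.e. of all linear forms `μ` on `𝒪^n` with `μ(e) = 0`. -/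
def higgsChartIdeal (φ : Matrix n n R) (a : n) : Ideal (ChartRing n R a) :=
  Ideal.span {f | ∃ μ : n → ChartRing n R a,
    ∑ k, μ k * coord a k = 0 ∧ f = ∑ k, μ k * ∑ l, const a (φ k l) * coord a l}

/-- The ideal sheaf on `ℙ(E)` of the Higgs Grassmannian `Hgrass₁(E, φ)`, where `E` is the trivial
bundle with fibre `R^n` on `Spec R`, with endomorphism `φ`. -/
def higgsSheaf (φ : Matrix n n R) : (PP n R).IdealSheafData :=
  sheafOfCharts (higgsChartIdeal φ)

/-- The Higgs Grassmannian of rank one Higgs subbundles of `(R^n, φ)`. On `Spec R = 𝔸¹` the sheaf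
`Ω¹` is free on `dx`, and the matrix `φ` stands for the Higgs field `φ dx`. -/
def Hgrass (φ : Matrix n n R) : Scheme := (higgsSheaf φ).subscheme

/-- The closed immersion of the Higgs Grassmannian in `ℙ(E)`. -/
def Hgrass.ι (φ : Matrix n n R) : Hgrass φ ⟶ PP n R := (higgsSheaf φ).subschemeι

/-- The projection `ρ₁` of the Higgs Grassmannian to the base. -/
def Hgrass.ρ (φ : Matrix n n R) : Hgrass φ ⟶ Spec (.of R) := Hgrass.ι φ ≫ PP.toSpec n R

/-- The homogeneous ideal generated by the quadrics
`∑ k, z_k (φ_jk z_i - φ_ik z_j)`. -/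
def higgsIdeal (φ : Matrix n n R) : Ideal (MvPolynomial n R) :=
  Ideal.span (Set.range fun p : n × n =>
    ∑ k, MvPolynomial.X k * (MvPolynomial.C (φ p.2 k) * MvPolynomial.X p.1
      - MvPolynomial.C (φ p.1 k) * MvPolynomial.X p.2))

end HiggsGrassmannian

/-! ### Fibres over the points of the affine line -/

section Fibre

/-- The closed point `x = b` of `𝔸¹ = Spec ℂ[x]`. -/
def pt (b : ℂ) : Spec (.of ℂ) ⟶ Spec (.of (Polynomial ℂ)) :=
  Spec.map (CommRingCat.ofHom (Polynomial.evalRingHom b))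

variable (n : Type)

/-- Evaluation at `x = b` of the coefficients of homogeneous polynomials. -/
def evalGraded (b : ℂ) : GradedRingHom (grading n (Polynomial ℂ)) (grading n ℂ) where
  __ := MvPolynomial.map (Polynomial.evalRingHom b)
  map_mem h := MvPolynomial.IsHomogeneous.map h _

lemma irrelevant_le_map (b : ℂ) : HomogeneousIdeal.irrelevant (grading n ℂ) ≤
    (HomogeneousIdeal.irrelevant (grading n (Polynomial ℂ))).map (evalGraded n b) := by
  rw [HomogeneousIdeal.irrelevant_le]
  intro i hi f hf
  have hf' : f.IsHomogeneous i := hf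
  change f ∈ ((HomogeneousIdeal.irrelevant (grading n (Polynomial ℂ))).map (evalGraded n b)).toIdeal
  rw [f.as_sum]
  refine Ideal.sum_mem _ fun m hm => ?_
  have h1 : (MvPolynomial.monomial m (Polynomial.C (f.coeff m)) : MvPolynomial n (Polynomial ℂ)) ∈
      HomogeneousIdeal.irrelevant (grading n (Polynomial ℂ)) := by
    refine HomogeneousIdeal.mem_irrelevant_of_mem _ hi ?_
    refine MvPolynomial.isHomogeneous_monomial _ ?_
    rw [Finsupp.degree_eq_weight_one]
    exact hf' (MvPolynomial.mem_support_iff.mp hm)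
  have h2 := Ideal.mem_map_of_mem (evalGraded n b) h1
  have h3 : evalGraded n b (MvPolynomial.monomial m (Polynomial.C (f.coeff m))) =
      MvPolynomial.monomial m (f.coeff m) := by
    change MvPolynomial.map (Polynomial.evalRingHom b) _ = _
    simp
  rw [h3] at h2
  exact h2

/-- The inclusion `ℙ(E_b) ⟶ ℙ(E)` of the fibre over `x = b` for a trivial bundle `E` on `𝔸¹`. -/
def fibreIncl (b : ℂ) : PP n ℂ ⟶ PP n (Polynomial ℂ) :=
  Proj.map (evalGraded n b) (irrelevant_le_map n b)

end Fibre

/-! ### Fat points and bundles -/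

/-- The curvilinear fat point `Spec ℂ[t]/(t^l)` of degree `l`. -/
abbrev fatPoint (l : ℕ) : Scheme :=
  Spec (.of (Polynomial ℂ ⧸ Ideal.span {(Polynomial.X : Polynomial ℂ) ^ l}))

/-- The structure morphism of the fat point. -/
def fatPoint.toSpec (l : ℕ) : fatPoint l ⟶ Spec (.of ℂ) :=
  Spec.map (CommRingCat.ofHom
    (algebraMap ℂ (Polynomial ℂ ⧸ Ideal.span {(Polynomial.X : Polynomial ℂ) ^ l})))

/-- `π : V ⟶ P` is a Zariski locally trivial bundle with fibre `F`, for `P` and `F` over `S`. -/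
def IsBundle {V P F S : Scheme.{0}} (π : V ⟶ P) (p : P ⟶ S) (q : F ⟶ S) : Prop :=
  ∀ x : P, ∃ U : P.Opens, x ∈ U ∧
    ∃ e : (π ⁻¹ᵁ U).toScheme ≅ pullback (U.ι ≫ p) q, e.hom ≫ pullback.fst (U.ι ≫ p) q = π ∣_ U

/-! ### The Higgs field with one eigenvalue, and the components -/

section Jordan

variable {s : ℕ} (i m : Fin s → ℕ)

/-- The index set of the standard frame of `E`: `⟨v, k, j⟩` is the `j`-th vector (counted from `0`)
of the `k`-th Jordan block of size `i v`. The lexicographic order identifies it with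
`{1, …, r}`, `r = ∑ v, m v * i v`. -/
abbrev Idx : Type := Σ v : Fin s, Fin (m v) × Fin (i v)

/-- The matrix in Jordan form with the eigenvalue `lam` and, for each `v`, `m v` upper triangular
Jordan blocks of size `i v`. -/
def jordan {R : Type} [CommRing R] (lam : R) : Matrix (Idx i m) (Idx i m) R := fun p q =>
  if p = q then lam
  else if p.1 = q.1 ∧ (p.2.1 : ℕ) = q.2.1 ∧ (p.2.2 : ℕ) + 1 = q.2.2 then 1
  else 0

variable (v : Fin s)

/-- The set `{(w, k, j) | j < i v}`, for `w ≤ v`: the first `i v` indices of a Jordan block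
of size `i w ≥ i v`. -/
def blockSet (w : Fin s) (k : Fin (m w)) : Set (Idx i m) :=
  {p | ∃ j : Fin (i w), (j : ℕ) < i v ∧ p = ⟨w, k, j⟩}

/-- The indices outside of all the sets `blockSet i m v w k`, `w ≤ v`. -/
def LL : Set (Idx i m) := {p | ∀ (w : Fin s) (k : Fin (m w)), w ≤ v → p ∉ blockSet i m v w k}

/-- The indices in some `blockSet i m v w k`, `w ≤ v`, that are not the least one in it. -/
def BB : Set (Idx i m) :=
  {p | ∃ (w : Fin s) (k : Fin (m w)), w ≤ v ∧ p ∈ blockSet i m v w k ∧ (p.2.2 : ℕ) ≠ 0}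

/-- The indices that are the greatest one in some `blockSet i m v w k`, `w ≤ v`. -/
def CC : Set (Idx i m) :=
  {p | ∃ (w : Fin s) (k : Fin (m w)), w ≤ v ∧ p ∈ blockSet i m v w k ∧ (p.2.2 : ℕ) + 1 = i v}

/-- The columns `(z_p, z_q)` of the matrix `M_v`: `p` and `q` are consecutive indices of one of the
sets `blockSet i m v w k`, `w ≤ v`. -/
def columns : Set (Idx i m × Idx i m) :=
  {c | ∃ (w : Fin s) (k : Fin (m w)), w ≤ v ∧ c.1 ∈ blockSet i m v w k ∧
    c.2 ∈ blockSet i m v w k ∧ (c.2.2.2 : ℕ) = c.1.2.2 + 1}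

/-- The matrix `M_v` with two rows. -/
def colMatrix : Matrix (Fin 2) (columns i m v) (MvPolynomial (Idx i m) ℂ) :=
  Matrix.of ![fun c => MvPolynomial.X c.1.1, fun c => MvPolynomial.X c.1.2]

/-- The ideal `(rk M ≤ 1)` generated by the `2 × 2` minors of a matrix with two rows. -/
def minorsIdeal {A C : Type} [CommRing A] (M : Matrix (Fin 2) C A) : Ideal A :=
  Ideal.span (Set.range fun c : C × C => (M.submatrix id ![c.1, c.2]).det)

/-- The ideal of the component `V_v`. -/
def componentIdeal : Ideal (MvPolynomial (Idx i m) ℂ) :=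
  Ideal.span {f | ∃ j ∈ LL i m v, f = MvPolynomial.X j} +
  Ideal.span {f | ∃ b ∈ BB i m v, ∃ c ∈ CC i m v, f = MvPolynomial.X b * MvPolynomial.X c} +
  minorsIdeal (colMatrix i m v)

/-- The component `V_v`, a closed subscheme of `ℙ^{r-1}`. -/
abbrev component : Scheme := zeroScheme (componentIdeal i m v)

/-- `d_v = -1 + m_1 + ⋯ + m_v` (the sum is positive when the multiplicities are). -/
def dd (m : Fin s → ℕ) (v : Fin s) : ℕ := (∑ w ∈ Finset.Iic v, m w) - 1

end Jordan

end HiggsGrass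

end

/-!
The Higgs Grassmannian is cut out by the quadrics `z_p N(z_q) - z_q N(z_p)`, where `N` is the
nilpotent part of the Jordan form, i.e. the shift in each Jordan block; the eigenvalue cancels
(`higgsIdeal_jordan`). Modulo these quadrics shifts can be moved from one factor of a monomial to
any other one. Hence a monomial is determined by the product `x ^ α` of the blocks of its factors
and by the sum `k` of their positions in the blocks, and it vanishes as soon as `k` is at least the
size of some block in `α`: one can move all the shifts to a coordinate of that block. This is
expressed by the homomorphism `z_p ↦ t ^ (position of p) x_(block of p)` (`shiftHom`), by
which a monomial goes to `x ^ α t ^ k` (`eval_eq_zero_of_shiftCoeff`).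

The same argument shows that the ideal of `V_v` is the kernel of this homomorphism to
`(ℂ[t]/(t ^ i_v))[x_b]`, with `b` running over the blocks of size at least `i_v`
(`componentIdeal_eq_shiftIdeal`; the other `x_b` go to `0`). A monomial `x ^ α t ^ k` vanishes in
the coordinate ring of the Higgs Grassmannian iff it does so in that of `V_v` for the smallest
block in `α`, and so the ideal of the former is the intersection of the ideals of the `V_v`
(`higgsIdeal_eq_iInf`). As `(t ^ i_v)` is primary with radical `(t)`, the ideal of `V_v` is primary,
and its radical is the kernel for `i_v` replaced by `1`. The last coordinate of a block of size
`i_v` shows that no component can be omitted.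

Geometrically, the homomorphism to `(ℂ[t]/(t ^ i_v))[x_b]` is onto after multiplication with any
`x_b`, so that it induces a closed immersion of the projective space over the fat point
`Spec ℂ[t]/(t ^ i_v)` with image `V_v` (`isClosedImmersion_map_and_ker`,
`truncMap_isClosedImmersion_and_ker`). Thus `V_v` is the product of a projective space and a fat
point: `π` is the projection, given by the base change `isPullback_PP_map`, and the closed point
`t = 0` gives a section of it, which is the reduction of `V_v` (`structure_of_isClosedImmersion`).

The statements on ideal sheaves are reduced to statements on homogeneous ideals in two steps. On the
chart `{z_a ≠ 0}` the ideal sheaf of a homogeneous ideal is that of the dehomogenized ideal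
(`comap_idealSheaf_chart`), and this construction commutes with base change
(`comap_idealSheaf_map`) and with finite intersections (`idealSheaf_iInf`).
-/

noncomputable section

namespace HiggsGrass

attribute [local instance] MvPolynomial.gradedAlgebra

/-! ### The coordinate rings of the standard charts -/

section ChartRing

variable {n : Type} {R : Type} [CommRing R]

/-- The localization `R[z_k | k ∈ n][1 / z_a]`, whose degree zero part is the chart ring. -/
abbrev ChartLoc (n R : Type) [CommRing R] (a : n) : Type :=
  Localization.Away (MvPolynomial.X a : MvPolynomial n R)

/-- The localization map `R[z_k | k ∈ n] → R[z_k | k ∈ n][1 / z_a]`. -/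
abbrev toLoc (a : n) : MvPolynomial n R →+* ChartLoc n R a := algebraMap _ _

lemma val_coord (a k : n) : (coord (R := R) a k).val =
    Localization.mk (MvPolynomial.X k : MvPolynomial n R)
      (⟨MvPolynomial.X a, 1, pow_one _⟩ : Submonoid.powers (MvPolynomial.X a)) := by
  rw [coord, HomogeneousLocalization.Away.val_mk]
  congr 1
  exact Subtype.ext (pow_one _)

lemma val_coord_mul (a k : n) : (coord (R := R) a k).val * toLoc a (MvPolynomial.X a) =
    toLoc a (MvPolynomial.X k) := by
  rw [val_coord, toLoc, ← Localization.mk_one_eq_algebraMap, ← Localization.mk_one_eq_algebraMap,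
    Localization.mk_mul, Localization.mk_eq_mk_iff, Localization.r_iff_exists]
  exact ⟨1, by simp; ring⟩

@[simp]
lemma coord_self (a : n) : coord (R := R) a a = 1 := by
  apply HomogeneousLocalization.val_injective
  rw [val_coord, HomogeneousLocalization.val_one]
  exact Localization.mk_self (⟨MvPolynomial.X a, 1, pow_one _⟩ :
    Submonoid.powers (MvPolynomial.X a : MvPolynomial n R))

lemma val_const (a : n) (r : R) : (const a r).val = toLoc a (MvPolynomial.C r) :=
  rfl

/-- Dehomogenization `z_k ↦ z_k / z_a`. -/
def dehom (a : n) : MvPolynomial n R →+* ChartRing n R a :=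
  MvPolynomial.eval₂Hom (const a) (coord a)

@[simp]
lemma dehom_X (a k : n) : dehom (R := R) a (MvPolynomial.X k) = coord a k := by simp [dehom]

@[simp]
lemma dehom_C (a : n) (r : R) : dehom a (MvPolynomial.C r) = const a r := by simp [dehom]

/-- A homogeneous polynomial of degree `N` dehomogenizes to `f / z_a ^ N`. -/
lemma val_dehom_mul (a : n) {N : ℕ} {f : MvPolynomial n R} (hf : f.IsHomogeneous N) :
    (dehom a f).val * toLoc a (MvPolynomial.X a) ^ N = toLoc a f := by
  let ι : ChartRing n R a →+* ChartLoc n R a := algebraMap _ _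
  have hι : ∀ x : ChartRing n R a, ι x = x.val := fun _ => rfl
  change ι (dehom a f) * _ = _
  rw [f.as_sum, map_sum, map_sum, map_sum, Finset.sum_mul]
  refine Finset.sum_congr rfl fun m hm => ?_
  have hd : m.degree = N := by
    rw [Finsupp.degree_eq_weight_one]; exact hf (MvPolynomial.mem_support_iff.mp hm)
  rw [MvPolynomial.monomial_eq, map_mul, map_mul, map_mul, dehom_C, hι (const _ _), val_const,
    mul_assoc]
  congr 1
  rw [Finsupp.prod, map_prod, map_prod, map_prod, ← hd, Finsupp.degree_apply,
    ← Finset.prod_pow_eq_pow_sum, ← Finset.prod_mul_distrib]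
  refine Finset.prod_congr rfl fun k _ => ?_
  rw [map_pow, map_pow, map_pow, dehom_X, hι, ← mul_pow, val_coord_mul]

lemma isUnit_toLoc_X (a : n) : IsUnit (toLoc (R := R) a (MvPolynomial.X a)) :=
  IsLocalization.map_units _ (⟨MvPolynomial.X a, 1, pow_one _⟩ :
    Submonoid.powers (MvPolynomial.X a : MvPolynomial n R))

lemma away_mk_eq_dehom (a : n) (N : ℕ) (f : MvPolynomial n R) (hf : f ∈ grading n R (N • 1)) :
    HomogeneousLocalization.Away.mk (grading n R) (X_mem a) N f hf = dehom a f := by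
  apply HomogeneousLocalization.val_injective
  have hf' : f.IsHomogeneous N := by simpa using hf
  rw [← ((isUnit_toLoc_X a).pow N).mul_left_inj, val_dehom_mul a hf',
    HomogeneousLocalization.Away.val_mk, ← map_pow, ← Localization.mk_one_eq_algebraMap,
    ← Localization.mk_one_eq_algebraMap,
    Localization.mk_mul, Localization.mk_eq_mk_iff, Localization.r_iff_exists]
  exact ⟨1, by simp; ring⟩

lemma exists_eq_dehom (a : n) (x : ChartRing n R a) :
    ∃ (N : ℕ) (f : MvPolynomial n R), f.IsHomogeneous N ∧ x = dehom a f := by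
  obtain ⟨N, f, hf, rfl⟩ := x.mk_surjective _ (X_mem a)
  exact ⟨N, f, by simpa using hf, away_mk_eq_dehom a N f hf⟩

lemma dehom_surjective (a : n) : Function.Surjective (dehom (R := R) a) := fun x => by
  obtain ⟨N, f, -, rfl⟩ := exists_eq_dehom a x
  exact ⟨f, rfl⟩

/-- A ring homomorphism on the chart is determined by its values on constants and coordinates. -/
lemma chart_hom_ext {a : n} {T : Type*} [CommRing T] {f g : ChartRing n R a →+* T}
    (hc : ∀ r, f (const a r) = g (const a r)) (hX : ∀ k, f (coord a k) = g (coord a k)) :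
    f = g := by
  have : f.comp (dehom a) = g.comp (dehom a) :=
    MvPolynomial.ringHom_ext (by simpa using hc) (by simpa using hX)
  exact (RingHom.cancel_right (dehom_surjective a)).mp this

section

variable {T : Type} [CommRing T] (a : n) (α : R →+* T) (t : n → T) (ht : t a = 1)

/-- The ring homomorphism `z_k ↦ t k` on `R[z_k | k ∈ n][1 / z_a]`, for `t a = 1`. -/
def chartLocLift : ChartLoc n R a →+* T :=
  IsLocalization.Away.lift (MvPolynomial.X a) (g := MvPolynomial.eval₂Hom α t) (by simp [ht])

lemma chartLocLift_toLoc (f : MvPolynomial n R) :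
    chartLocLift a α t ht (toLoc a f) = MvPolynomial.eval₂Hom α t f :=
  IsLocalization.Away.lift_eq ..

/-- The ring homomorphism `z_k / z_a ↦ t k` on the chart `{z_a ≠ 0}`, for `t a = 1`. -/
def chartLift : ChartRing n R a →+* T :=
  (chartLocLift a α t ht).comp (algebraMap _ _)

lemma chartLift_apply (x : ChartRing n R a) :
    chartLift a α t ht x = chartLocLift a α t ht x.val := rfl

@[simp]
lemma chartLift_const (r : R) : chartLift a α t ht (const a r) = α r := by
  rw [chartLift_apply, val_const, chartLocLift_toLoc]
  simp

@[simp]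
lemma chartLift_coord (k : n) : chartLift a α t ht (coord a k) = t k := by
  have h := congrArg (chartLocLift a α t ht) (val_coord_mul (R := R) a k)
  rw [map_mul, chartLocLift_toLoc, chartLocLift_toLoc] at h
  simpa [ht, chartLift_apply] using h

end

/-- The chart `{z_a ≠ 0}` is the affine space with coordinates `z_k / z_a`, `k ≠ a`. -/
def chartEquiv (a : n) : ChartRing n R a ≃+* MvPolynomial {k : n // k ≠ a} R := by
  classical
  exact RingEquiv.ofRingHom
    (chartLift a MvPolynomial.C (fun k => if h : k ≠ a then MvPolynomial.X ⟨k, h⟩ else 1) (by simp))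
    (MvPolynomial.eval₂Hom (const a) fun k => coord a k.1)
    (MvPolynomial.ringHom_ext (by simp) fun k => by simp [k.2])
    (chart_hom_ext (by simp) fun k => by
      by_cases h : k = a
      · subst h; simp
      · simp [h])

/-- The retraction `z_k ↦ z_k / z_a` of the localization at `z_a` onto its degree zero part. -/
lemma exists_retraction (a : n) :
    ∃ D : ChartLoc n R a →+* ChartRing n R a,
      D.comp (toLoc a) = dehom a ∧ ∀ x : ChartRing n R a, D x.val = x := by
  refine ⟨chartLocLift a (const a) (coord a) (coord_self a),
    RingHom.ext fun f => chartLocLift_toLoc _ _ _ (coord_self a) f, fun x => ?_⟩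
  have : chartLift a (const a) (coord a) (coord_self a) = RingHom.id (ChartRing n R a) :=
    chart_hom_ext (by simp) (by simp)
  exact congrArg (fun g => g x) this

lemma map_le_of_isHomogeneous {I : Ideal (MvPolynomial n R)} (hI : I.IsHomogeneous (grading n R))
    {T : Type*} [CommRing T] (φ : MvPolynomial n R →+* T) {K : Ideal T}
    (h : ∀ N f, f ∈ I → f.IsHomogeneous N → φ f ∈ K) : I.map φ ≤ K := by
  classical
  rw [Ideal.map_le_iff_le_comap]
  intro f hf
  rw [← DirectSum.sum_support_decompose (grading n R) f]
  exact Ideal.sum_mem _ fun N _ => h N _ (hI N hf)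
    ((MvPolynomial.mem_homogeneousSubmodule _ _).mp (SetLike.coe_mem _))

/-- The ideal of `V₊(I)` on a standard chart, as it occurs in `idealSheaf`, is generated by the
dehomogenizations of the elements of `I`. -/
lemma comap_map_eq_map_dehom (a : n) {I : Ideal (MvPolynomial n R)}
    (hI : I.IsHomogeneous (grading n R)) :
    (I.map (algebraMap (MvPolynomial n R) (ChartLoc n R a))).comap
      (algebraMap (ChartRing n R a) (ChartLoc n R a)) = I.map (dehom a) := by
  apply le_antisymm
  · obtain ⟨D, h1, h2⟩ := exists_retraction (R := R) a
    intro x hx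
    rw [← h2 x, ← h1, ← Ideal.map_map]
    exact Ideal.mem_map_of_mem D hx
  · refine map_le_of_isHomogeneous hI _ fun N f hf hN => ?_
    have := Ideal.mem_map_of_mem (toLoc a) hf
    rw [← val_dehom_mul a hN] at this
    exact (Ideal.mul_unit_mem_iff_mem _ ((isUnit_toLoc_X a).pow N)).mp this

end ChartRing

/-! ### Ideal sheaves on affine schemes and on charts -/

section SpecIdeal

variable {A B : Type} [CommRing A] [CommRing B]

/-- The ideal sheaf on `Spec A` of an ideal of `A`. -/
def specIdeal (J : Ideal A) : (Spec (.of A)).IdealSheafData :=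
  (Spec.map (CommRingCat.ofHom (Ideal.Quotient.mk J))).ker

lemma ker_SpecMap (f : A →+* B) :
    (Spec.map (CommRingCat.ofHom f)).ker = Scheme.IdealSheafData.ofIdealTop
      ((RingHom.ker f).comap (Scheme.ΓSpecIso (.of A)).hom.hom) := by
  rw [Scheme.ker_of_isAffine]
  congr 1
  have h : (Spec.map (CommRingCat.ofHom f)).appTop ≫ (Scheme.ΓSpecIso (.of B)).hom =
      (Scheme.ΓSpecIso (.of A)).hom ≫ CommRingCat.ofHom f := Scheme.ΓSpecIso_naturality _
  ext x
  rw [RingHom.mem_ker, Ideal.mem_comap, RingHom.mem_ker]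
  have h2 := congrArg (fun g => g.hom x) h
  simp only [CommRingCat.hom_comp, RingHom.comp_apply, CommRingCat.hom_ofHom] at h2
  rw [← h2]
  exact (map_eq_zero_iff _
    (ConcreteCategory.bijective_of_isIso (Scheme.ΓSpecIso (.of B)).hom).1).symm

lemma specIdeal_eq_ofIdealTop (J : Ideal A) : specIdeal J =
    Scheme.IdealSheafData.ofIdealTop (J.comap (Scheme.ΓSpecIso (.of A)).hom.hom) := by
  rw [specIdeal, ker_SpecMap, Ideal.mk_ker]

lemma ker_SpecMap_eq_specIdeal (f : A →+* B) :
    (Spec.map (CommRingCat.ofHom f)).ker = specIdeal (RingHom.ker f) := by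
  rw [ker_SpecMap, specIdeal_eq_ofIdealTop]

lemma specIdeal_surjective : Function.Surjective (specIdeal (A := A)) := fun K => by
  obtain ⟨I, rfl⟩ := (Scheme.IdealSheafData.equivOfIsAffine (X := Spec (.of A))).symm.surjective K
  refine ⟨I.comap (Scheme.ΓSpecIso (.of A)).inv.hom, ?_⟩
  rw [specIdeal_eq_ofIdealTop, Ideal.comap_comap, ← CommRingCat.hom_comp, Iso.hom_inv_id]
  rfl

lemma specIdeal_le_specIdeal {J K : Ideal A} : specIdeal J ≤ specIdeal K ↔ J ≤ K := by
  rw [specIdeal_eq_ofIdealTop, specIdeal_eq_ofIdealTop]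
  refine (map_le_map_iff (Scheme.IdealSheafData.equivOfIsAffine (X := Spec (.of A))).symm).trans
    (Ideal.comap_le_comap_iff_of_surjective _ ?_ _ _)
  exact (ConcreteCategory.bijective_of_isIso (Scheme.ΓSpecIso (.of A)).hom).2

lemma map_specIdeal (f : A →+* B) (K : Ideal B) :
    (specIdeal K).map (Spec.map (CommRingCat.ofHom f)) = specIdeal (K.comap f) := by
  rw [specIdeal, ← Scheme.Hom.ker_comp, ← Spec.map_comp, ← CommRingCat.ofHom_comp,
    ker_SpecMap_eq_specIdeal, ← RingHom.comap_ker, Ideal.mk_ker]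

lemma comap_specIdeal (f : A →+* B) (J : Ideal A) :
    (specIdeal J).comap (Spec.map (CommRingCat.ofHom f)) = specIdeal (J.map f) := by
  refine eq_of_forall_ge_iff fun K => ?_
  obtain ⟨K, rfl⟩ := specIdeal_surjective K
  rw [← Scheme.IdealSheafData.le_map_iff_comap_le, map_specIdeal, specIdeal_le_specIdeal,
    specIdeal_le_specIdeal, Ideal.map_le_iff_le_comap]

end SpecIdeal

section Glue

variable {X : Scheme.{0}}

/-- Pullback of ideal sheaves along an open immersion commutes with finite intersections. -/
lemma comap_iInf_of_isOpenImmersion {Y : Scheme.{0}} {ι : Type*} [Finite ι]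
    (K : ι → X.IdealSheafData) (f : Y ⟶ X) [IsOpenImmersion f] :
    (⨅ i, K i).comap f = ⨅ i, (K i).comap f := by
  ext U x
  rw [Scheme.IdealSheafData.ideal_comap_of_isOpenImmersion, Scheme.IdealSheafData.ideal_iInf,
    Scheme.IdealSheafData.ideal_iInf]
  simp only [iInf_apply, Ideal.mem_comap, Ideal.mem_iInf,
    Scheme.IdealSheafData.ideal_comap_of_isOpenImmersion]

/-- The kernel of a morphism commutes with restriction to an open subscheme. -/
lemma comap_ker_of_isPullback {Y U V : Scheme.{0}} (f : Y ⟶ X) (f' : U ⟶ V) (iU : U ⟶ Y)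
    (iV : V ⟶ X) [IsOpenImmersion iV] [QuasiCompact f] (H : IsPullback f' iU iV f) :
    f.ker.comap iV = f'.ker := by
  ext1
  funext W
  rw [Scheme.ker_ideal_of_isPullback_of_isOpenImmersion f f' iU iV H,
    Scheme.IdealSheafData.ideal_comap_of_isOpenImmersion]

/-- Ideal sheaves on an open cover that agree on the overlaps are the restrictions of the
intersection of their direct images. -/
lemma comap_iInf_map {ι : Type} [Finite ι] {U : ι → Scheme.{0}} (f : ∀ i, U i ⟶ X)
    [∀ i, IsOpenImmersion (f i)] [∀ i, QuasiCompact (f i)] (J : ∀ i, (U i).IdealSheafData)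
    (hJ : ∀ i j, (J i).comap (pullback.fst (f i) (f j)) = (J j).comap (pullback.snd (f i) (f j)))
    (i : ι) : (⨅ j, (J j).map (f j)).comap (f i) = J i := by
  apply le_antisymm
  · rw [← Scheme.IdealSheafData.le_map_iff_comap_le]
    exact iInf_le _ i
  · -- On the overlap with `U j` the `j`-th member of the intersection agrees with `J j`.
    rw [comap_iInf_of_isOpenImmersion]
    refine le_iInf fun j => ?_
    rw [Scheme.IdealSheafData.map, comap_ker_of_isPullback _ _ _ _
      (IsPullback.of_hasPullback (f i) ((J j).subschemeι ≫ f j)),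
      ← Scheme.IdealSheafData.map_bot, Scheme.IdealSheafData.le_map_iff_comap_le]
    let l : pullback (f i) ((J j).subschemeι ≫ f j) ⟶ pullback (f i) (f j) :=
      pullback.lift (pullback.fst _ _) (pullback.snd _ _ ≫ (J j).subschemeι)
        (by simp [pullback.condition])
    have h1 : l ≫ pullback.fst _ _ = pullback.fst _ _ := pullback.lift_fst ..
    have h2 : l ≫ pullback.snd _ _ = pullback.snd _ _ ≫ (J j).subschemeι := pullback.lift_snd ..
    have h3 : (J j).comap (J j).subschemeι = ⊥ := by
      rw [← le_bot_iff, ← Scheme.IdealSheafData.le_map_iff_comap_le,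
        Scheme.IdealSheafData.map_bot, Scheme.IdealSheafData.ker_subschemeι]
    rw [← h1, Scheme.IdealSheafData.comap_comp, hJ, ← Scheme.IdealSheafData.comap_comp, h2,
      Scheme.IdealSheafData.comap_comp, h3, Scheme.IdealSheafData.comap_bot]

/-- Ideal sheaves may be compared on an open cover. -/
lemma le_of_comap_le (𝒰 : X.OpenCover) {I K : X.IdealSheafData}
    (h : ∀ i, I.comap (𝒰.f i) ≤ K.comap (𝒰.f i)) : I ≤ K := by
  rw [← K.ker_subschemeι, ← K.subschemeι.iInf_ker_openCover_map_comp (𝒰.pullback₁ K.subschemeι)]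
  refine le_iInf fun (i : 𝒰.I₀) => ?_
  change I ≤ (pullback.fst K.subschemeι (𝒰.f i) ≫ K.subschemeι).ker
  rw [pullback.condition, ← pullbackSymmetry_hom_comp_fst, Category.assoc,
    Scheme.Hom.ker_comp_of_isIso, Scheme.Hom.ker_comp, Scheme.IdealSheafData.le_map_iff_comap_le]
  exact h i

lemma eq_of_comap_eq (𝒰 : X.OpenCover) {I K : X.IdealSheafData}
    (h : ∀ i, I.comap (𝒰.f i) = K.comap (𝒰.f i)) : I = K :=
  le_antisymm (le_of_comap_le 𝒰 fun i => (h i).le) (le_of_comap_le 𝒰 fun i => (h i).ge)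

end Glue

section Charts

variable {n : Type} {R : Type} [CommRing R]

lemma irrelevant_le_span_X : (HomogeneousIdeal.irrelevant (grading n R)).toIdeal ≤
    Ideal.span (Set.range (MvPolynomial.X : n → MvPolynomial n R)) := by
  rw [HomogeneousIdeal.toIdeal_irrelevant_le]
  intro i hi f hf
  have hf' : f.IsHomogeneous i := hf
  rw [f.as_sum]
  refine Ideal.sum_mem _ fun m hm => ?_
  have hd : m.degree = i := by
    rw [Finsupp.degree_eq_weight_one]; exact hf' (MvPolynomial.mem_support_iff.mp hm)
  have hm0 : m ≠ 0 := by rintro rfl; simp at hd; omega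
  obtain ⟨k, hk⟩ := Finsupp.ne_iff.mp hm0
  refine Ideal.mem_of_dvd _ ?_ (Ideal.subset_span ⟨k, rfl⟩)
  rw [MvPolynomial.X_dvd_monomial]
  exact Or.inr hk

variable (n R) in
/-- The standard affine open cover of projective space. -/
def chartCover : (PP n R).AffineOpenCover :=
  Proj.affineOpenCoverOfIrrelevantLESpan (grading n R) MvPolynomial.X X_mem
    (fun _ => Nat.one_pos) irrelevant_le_span_X

instance (a : n) : IsOpenImmersion (chart (R := R) a) :=
  inferInstanceAs (IsOpenImmersion (Proj.awayι _ _ _ _))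

lemma chart_toSpec (a : n) : chart a ≫ PP.toSpec n R = Spec.map (CommRingCat.ofHom (const a)) := by
  rw [chart, PP.toSpec, Proj.awayι_toSpecZero_assoc, ← Spec.map_comp]
  rfl

lemma sheafOfCharts_eq (J : ∀ a : n, Ideal (ChartRing n R a)) :
    sheafOfCharts J = ⨅ a, (specIdeal (J a)).map (chart a) := by
  simp only [sheafOfCharts, specIdeal, Scheme.Hom.ker_comp]

lemma eq_of_comap_chart_eq {I K : (PP n R).IdealSheafData}
    (h : ∀ a, I.comap (chart a) = K.comap (chart a)) : I = K :=
  eq_of_comap_eq (chartCover n R).openCover h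

/-- The inclusion of the chart `{z_a ≠ 0}` in the intersection `{z_a ≠ 0} ∩ {z_b ≠ 0}`, on
functions. -/
def overlap (a b : n) : ChartRing n R a →+*
    HomogeneousLocalization.Away (grading n R) (MvPolynomial.X a * MvPolynomial.X b) :=
  HomogeneousLocalization.awayMap (grading n R) (X_mem b) rfl

/-- The inclusion of the chart `{z_b ≠ 0}` in the intersection `{z_a ≠ 0} ∩ {z_b ≠ 0}`, on
functions. -/
def overlap' (a b : n) : ChartRing n R b →+*
    HomogeneousLocalization.Away (grading n R) (MvPolynomial.X a * MvPolynomial.X b) :=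
  HomogeneousLocalization.awayMap (grading n R) (X_mem a) (mul_comm _ _)

lemma overlap_coord_mul (a b k : n) :
    overlap (R := R) a b (coord a b) * overlap' a b (coord b k) = overlap a b (coord a k) := by
  apply HomogeneousLocalization.val_injective
  rw [HomogeneousLocalization.val_mul, overlap, overlap', coord, coord, coord,
    HomogeneousLocalization.awayMap_mk, HomogeneousLocalization.awayMap_mk,
    HomogeneousLocalization.awayMap_mk]
  rw [HomogeneousLocalization.Away.val_mk, HomogeneousLocalization.Away.val_mk,
    HomogeneousLocalization.Away.val_mk, Localization.mk_mul, Localization.mk_eq_mk_iff,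
    Localization.r_iff_exists]
  exact ⟨1, by simp; ring⟩

lemma overlap_coord_mul' (a b : n) :
    overlap (R := R) a b (coord a b) * overlap' a b (coord b a) = 1 := by
  rw [overlap_coord_mul, coord_self, map_one]

lemma overlap_const (a b : n) (r : R) : overlap a b (const a r) = overlap' a b (const b r) := by
  rw [overlap, overlap']
  simp only [const, RingHom.comp_apply, HomogeneousLocalization.awayMap_fromZeroRingHom]

lemma eval₂Hom_mul_of_isHomogeneous {T : Type*} [CommRing T] (α : R →+* T) (u : T) (t : n → T)
    {N : ℕ} {f : MvPolynomial n R} (hf : f.IsHomogeneous N) :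
    MvPolynomial.eval₂Hom α (fun k => u * t k) f = u ^ N * MvPolynomial.eval₂Hom α t f := by
  rw [f.as_sum, map_sum, map_sum, Finset.mul_sum]
  refine Finset.sum_congr rfl fun m hm => ?_
  have hd : m.degree = N := by
    rw [Finsupp.degree_eq_weight_one]; exact hf (MvPolynomial.mem_support_iff.mp hm)
  simp only [MvPolynomial.coe_eval₂Hom, MvPolynomial.eval₂_monomial, Finsupp.prod, mul_pow,
    Finset.prod_mul_distrib]
  rw [Finset.prod_pow_eq_pow_sum, ← Finsupp.degree_apply, hd]
  ring

lemma overlap_dehom (a b : n) {N : ℕ} {f : MvPolynomial n R} (hf : f.IsHomogeneous N) :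
    overlap a b (dehom a f) = overlap a b (coord a b) ^ N * overlap' a b (dehom b f) := by
  have h1 : (overlap a b).comp (dehom a) = MvPolynomial.eval₂Hom
      ((overlap' a b).comp (const (R := R) b))
      (fun k => overlap a b (coord a b) * overlap' a b (coord b k)) :=
    MvPolynomial.ringHom_ext (by simp [overlap_const]) (by simp [overlap_coord_mul])
  have h2 : (overlap' a b).comp (dehom b) = MvPolynomial.eval₂Hom
      ((overlap' a b).comp (const (R := R) b)) (fun k => overlap' a b (coord b k)) :=
    MvPolynomial.ringHom_ext (by simp) (by simp)
  rw [← RingHom.comp_apply, ← RingHom.comp_apply, h1, h2, eval₂Hom_mul_of_isHomogeneous _ _ _ hf]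

lemma map_overlap_eq {I : Ideal (MvPolynomial n R)} (hI : I.IsHomogeneous (grading n R))
    (a b : n) : (I.map (dehom a)).map (overlap a b) = (I.map (dehom b)).map (overlap' a b) := by
  rw [Ideal.map_map, Ideal.map_map]
  have hu : IsUnit (overlap (R := R) a b (coord a b)) :=
    IsUnit.of_mul_eq_one _ (overlap_coord_mul' a b)
  apply le_antisymm <;> refine map_le_of_isHomogeneous hI _ fun N f hf hN => ?_
  · rw [RingHom.comp_apply, overlap_dehom a b hN]
    exact Ideal.mul_mem_left _ _ (Ideal.mem_map_of_mem ((overlap' a b).comp (dehom b)) hf)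
  · rw [RingHom.comp_apply, ← Ideal.unit_mul_mem_iff_mem _ (hu.pow N), ← overlap_dehom a b hN]
    exact Ideal.mem_map_of_mem ((overlap a b).comp (dehom a)) hf

/-- The ideal sheaf of a homogeneous ideal restricts on each standard chart to the ideal sheaf of
the dehomogenized ideal. -/
lemma comap_idealSheaf_chart [Finite n] {I : Ideal (MvPolynomial n R)}
    (hI : I.IsHomogeneous (grading n R)) (a : n) :
    (idealSheaf I).comap (chart a) = specIdeal (I.map (dehom a)) := by
  rw [idealSheaf, sheafOfCharts_eq]
  simp only [comap_map_eq_map_dehom _ hI]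
  refine comap_iInf_map (fun a => chart a) (fun a => specIdeal (I.map (dehom a))) (fun a b => ?_) a
  let e : pullback (chart a) (chart b) ≅ Spec (.of (HomogeneousLocalization.Away (grading n R)
      (MvPolynomial.X a * MvPolynomial.X b))) :=
    Proj.pullbackAwayιIso (grading n R) (X_mem a) Nat.one_pos (X_mem b) Nat.one_pos rfl
  have h1 : pullback.fst (chart a) (chart b) =
      e.hom ≫ Spec.map (CommRingCat.ofHom (overlap (R := R) a b)) :=
    (Proj.pullbackAwayιIso_hom_SpecMap_awayMap_left ..).symm
  have h2 : pullback.snd (chart a) (chart b) =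
      e.hom ≫ Spec.map (CommRingCat.ofHom (overlap' (R := R) a b)) :=
    (Proj.pullbackAwayιIso_hom_SpecMap_awayMap_right ..).symm
  rw [h1, h2, Scheme.IdealSheafData.comap_comp, Scheme.IdealSheafData.comap_comp, comap_specIdeal,
    comap_specIdeal, map_overlap_eq hI]

end Charts

/-! ### Base change of projective space -/

/-- A morphism of projective spectra is on `{z_a ≠ 0}` the spectrum of the homomorphism of
homogeneous localizations. -/
lemma exists_isPullback_awayι {n n' R S : Type} [CommRing R] [CommRing S]
    (φ : GradedRingHom (grading n R) (grading n' S))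
    (hφ : HomogeneousIdeal.irrelevant (grading n' S) ≤
      (HomogeneousIdeal.irrelevant (grading n R)).map φ) (a : n) (y : MvPolynomial n' S)
    (hy : φ (MvPolynomial.X a) = y) (hy1 : y ∈ grading n' S 1) :
    ∃ ρ : ChartRing n R a →+* HomogeneousLocalization.Away (grading n' S) y,
      (∀ N (p : MvPolynomial n R) (hp : p ∈ grading n R (N • 1)), ρ (dehom a p) =
        HomogeneousLocalization.Away.mk (grading n' S) hy1 N (φ p) (φ.2 hp)) ∧
      IsPullback (Spec.map (CommRingCat.ofHom ρ)) (Proj.awayι (grading n' S) y hy1 Nat.one_pos)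
        (chart a) (Proj.map φ hφ) := by
  subst hy
  refine ⟨HomogeneousLocalization.Away.map φ (MvPolynomial.X a), fun N p hp => ?_, ?_⟩
  · rw [← away_mk_eq_dehom a N p hp, HomogeneousLocalization.Away.map_mk]
  · refine IsOpenImmersion.isPullback _ _ _ _
      (Proj.awayι_comp_map φ hφ Nat.one_pos (MvPolynomial.X a) (X_mem a)) ?_
    rw [Proj.opensRange_awayι, ← Proj.map_preimage_basicOpen (hf := hφ)]
    exact congrArg (Proj.map φ hφ ⁻¹ᵁ ·)
      (Proj.opensRange_awayι (grading n R) (MvPolynomial.X a) (X_mem a) Nat.one_pos)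

section BaseChange

variable (n : Type) {R S T : Type} [CommRing R] [CommRing S] [CommRing T] (f : R →+* S)
  (g : S →+* T)

/-- The graded ring homomorphism `R[z_k | k ∈ n] → S[z_k | k ∈ n]` of a ring homomorphism
`R → S`. -/
def mapGraded : GradedRingHom (grading n R) (grading n S) where
  __ := MvPolynomial.map f
  map_mem h := MvPolynomial.IsHomogeneous.map h _

lemma mapGraded_apply (p : MvPolynomial n R) : mapGraded n f p = MvPolynomial.map f p := rfl

lemma irrelevant_le_of_X_mem {n' : Type} {S' : Type} [CommRing S']
    (φ : GradedRingHom (grading n' S') (grading n R))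
    (h : ∀ k, ∃ j, φ (MvPolynomial.X j) = MvPolynomial.X k) :
    HomogeneousIdeal.irrelevant (grading n R) ≤
      (HomogeneousIdeal.irrelevant (grading n' S')).map φ := by
  have : (HomogeneousIdeal.irrelevant (grading n R)).toIdeal ≤
      ((HomogeneousIdeal.irrelevant (grading n' S')).map φ).toIdeal := by
    refine irrelevant_le_span_X.trans (Ideal.span_le.mpr ?_)
    rintro _ ⟨k, rfl⟩
    obtain ⟨j, hj⟩ := h k
    rw [← hj]
    exact Ideal.mem_map_of_mem φ
      (HomogeneousIdeal.mem_irrelevant_of_mem _ Nat.one_pos (X_mem j))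
  exact this

lemma irrelevant_le_mapGraded : HomogeneousIdeal.irrelevant (grading n S) ≤
    (HomogeneousIdeal.irrelevant (grading n R)).map (mapGraded n f) :=
  irrelevant_le_of_X_mem n _ fun k => ⟨k, by simp [mapGraded_apply]⟩

/-- The morphism `ℙ(S^n) ⟶ ℙ(R^n)` of a ring homomorphism `R → S`. -/
def PP.map : PP n S ⟶ PP n R := Proj.map (mapGraded n f) (irrelevant_le_mapGraded n f)

lemma PP.map_comp : PP.map n (g.comp f) = PP.map n g ≫ PP.map n f := by
  rw [PP.map, PP.map, PP.map, ← Proj.map_comp]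
  congr 1
  ext p : 1
  simp [mapGraded_apply, MvPolynomial.map_map]

lemma PP.map_id : PP.map n (RingHom.id R) = 𝟙 _ := by
  rw [PP.map, ← Proj.map_id]
  congr 1
  ext p : 1
  exact MvPolynomial.map_id p

variable {n}

/-- The morphism `ℙ(S^n) ⟶ ℙ(R^n)` on the coordinate rings of the standard charts. -/
def chartMap (a : n) : ChartRing n R a →+* ChartRing n S a :=
  chartLift a ((const a).comp f) (coord a) (coord_self a)

@[simp]
lemma chartMap_const (a : n) (r : R) : chartMap f a (const a r) = const a (f r) := by
  simp [chartMap]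

@[simp]
lemma chartMap_coord (a k : n) : chartMap f a (coord a k) = coord a k := by
  simp [chartMap]

lemma isPullback_chart_map (a : n) : IsPullback (Spec.map (CommRingCat.ofHom (chartMap f a)))
    (chart a) (chart a) (PP.map n f) := by
  obtain ⟨ρ, h1, h2⟩ := exists_isPullback_awayι (mapGraded n f) (irrelevant_le_mapGraded n f) a
    (MvPolynomial.X a) (by simp [mapGraded_apply]) (X_mem a)
  have : ρ = chartMap f a := by
    refine chart_hom_ext (fun r => ?_) (fun k => ?_)
    · rw [← dehom_C, h1 0 _ (by simp), away_mk_eq_dehom]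
      simp [mapGraded_apply]
    · rw [← dehom_X, h1 1 _ (X_mem k), away_mk_eq_dehom]
      simp [mapGraded_apply]
  rw [← this]
  exact h2

lemma isPullback_Spec_chartMap (a : n) : IsPullback (Spec.map (CommRingCat.ofHom (chartMap f a)))
    (Spec.map (CommRingCat.ofHom (const a))) (Spec.map (CommRingCat.ofHom (const a)))
    (Spec.map (CommRingCat.ofHom f)) := by
  refine isPullback_SpecMap_of_isPushout _ _ _ _ ?_
  have h : CommRingCat.ofHom (const (n := n) a) ≫ CommRingCat.ofHom (chartMap f a) =
      CommRingCat.ofHom f ≫ CommRingCat.ofHom (const a) := by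
    ext r; simp
  refine ⟨⟨h⟩, ⟨PushoutCocone.IsColimit.mk _ (fun s => CommRingCat.ofHom
    (chartLift a s.inr.hom (fun k => s.inl.hom (coord a k)) (by simp))) ?_ ?_ ?_⟩⟩
  · intro s
    ext1
    refine chart_hom_ext (fun r => ?_) (fun k => ?_)
    · have := congrArg (fun g => g.hom r) s.condition
      simpa using this.symm
    · simp
  · intro s
    ext r
    simp
  · intro s m h1 h2
    ext1
    refine chart_hom_ext (fun r => ?_) (fun k => ?_)
    · simpa using congrArg (fun g => g.hom r) h2
    · simpa using congrArg (fun g => g.hom (coord a k)) h1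

/-- Projective space commutes with base change. -/
lemma isPullback_PP_map : IsPullback (PP.map n f) (PP.toSpec n S) (PP.toSpec n R)
    (Spec.map (CommRingCat.ofHom f)) := by
  refine Scheme.isPullback_of_openCover _ _ _ _ (chartCover n R).openCover fun (a : n) => ?_
  change IsPullback (pullback.snd (PP.map n f) (chart a)) (pullback.fst (PP.map n f) (chart a) ≫
    PP.toSpec n S) (chart a ≫ PP.toSpec n R) _
  have h := isPullback_Spec_chartMap f a
  rw [← chart_toSpec, ← chart_toSpec] at h
  let e := (isPullback_chart_map f a).flip.isoPullback
  refine IsPullback.of_iso h e (Iso.refl _) (Iso.refl _) (Iso.refl _) ?_ ?_ ?_ ?_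
  · simp [e]
  · simp [e]
  · simp
  · simp

lemma isHomogeneous_map {I : Ideal (MvPolynomial n R)} (hI : I.IsHomogeneous (grading n R)) :
    (I.map (MvPolynomial.map f)).IsHomogeneous (grading n S) :=
  (HomogeneousIdeal.map (mapGraded n f) (⟨I, hI⟩ : HomogeneousIdeal (grading n R))).isHomogeneous

/-- Pulling back the ideal sheaf of a homogeneous ideal along `ℙ(S^n) ⟶ ℙ(R^n)`. -/
lemma comap_idealSheaf_map [Finite n] {I : Ideal (MvPolynomial n R)}
    (hI : I.IsHomogeneous (grading n R)) :
    (idealSheaf I).comap (PP.map n f) = idealSheaf (I.map (MvPolynomial.map f)) := by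
  refine eq_of_comap_chart_eq fun a => ?_
  rw [← Scheme.IdealSheafData.comap_comp, ← (isPullback_chart_map f a).w,
    Scheme.IdealSheafData.comap_comp, comap_idealSheaf_chart hI, comap_specIdeal,
    comap_idealSheaf_chart (isHomogeneous_map f hI), Ideal.map_map, Ideal.map_map]
  congr 2
  exact MvPolynomial.ringHom_ext (by simp) (by simp)

end BaseChange

/-! ### Closed immersions between projective spaces -/

section ProjMap

variable {n n' R S : Type} [CommRing R] [CommRing S]
    (φ : GradedRingHom (grading n R) (grading n' S))
    (hφ : HomogeneousIdeal.irrelevant (grading n' S) ≤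
      (HomogeneousIdeal.irrelevant (grading n R)).map φ)

lemma isHomogeneous_ker : (RingHom.ker φ).IsHomogeneous (grading n R) :=
  ((⊥ : HomogeneousIdeal (grading n' S)).comap φ).isHomogeneous

/-- A graded homomorphism that is surjective up to multiplication with powers of the images of the
coordinates induces a closed immersion; its ideal sheaf is that of the kernel. -/
theorem isClosedImmersion_map_and_ker [Finite n]
    (h : ∀ (a : n) (N : ℕ) (q : MvPolynomial n' S), q.IsHomogeneous N →
      ∃ (M : ℕ) (p : MvPolynomial n R), p.IsHomogeneous (M + N) ∧
        φ p = φ (MvPolynomial.X a) ^ M * q) :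
    IsClosedImmersion (Proj.map φ hφ) ∧ (Proj.map φ hφ).ker = idealSheaf (RingHom.ker φ) := by
  have hc : ∀ a : n, ∃ (y : MvPolynomial n' S) (hy : y ∈ grading n' S 1)
      (ρ : ChartRing n R a →+* HomogeneousLocalization.Away (grading n' S) y),
      Function.Surjective ρ ∧ RingHom.ker ρ = (RingHom.ker φ).map (dehom a) ∧
      IsPullback (Spec.map (CommRingCat.ofHom ρ)) (Proj.awayι (grading n' S) y hy Nat.one_pos)
        (chart a) (Proj.map φ hφ) := by
    intro a
    have hy : φ (MvPolynomial.X a) ∈ grading n' S 1 := φ.2 (X_mem a)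
    obtain ⟨ρ, h1, h2⟩ := exists_isPullback_awayι φ hφ a _ rfl hy
    refine ⟨_, hy, ρ, ?_, ?_, h2⟩
    · -- A fraction `q / y ^ N` equals `φ p / y ^ (M + N)`, for `y = φ z_a`.
      intro x
      obtain ⟨N, q, hq, rfl⟩ := x.mk_surjective _ hy
      obtain ⟨M, p, hp, hpq⟩ := h a N q (by simpa using hq)
      refine ⟨dehom a p, ?_⟩
      rw [h1 (M + N) p (by simpa using hp)]
      apply HomogeneousLocalization.val_injective
      rw [HomogeneousLocalization.Away.val_mk, HomogeneousLocalization.Away.val_mk,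
        Localization.mk_eq_mk_iff, Localization.r_iff_exists]
      exact ⟨1, by simp [hpq]; ring⟩
    · apply le_antisymm
      · -- If `φ p / y ^ N = 0`, then `z_a ^ M p ∈ ker φ` for some `M`.
        -- As `z_a` dehomogenizes to `1`, this has the same dehomogenization as `p`.
        intro x hx
        obtain ⟨N, p, hp, rfl⟩ := exists_eq_dehom a x
        rw [RingHom.mem_ker, h1 N p (by simpa using hp)] at hx
        replace hx := congrArg HomogeneousLocalization.val hx
        rw [HomogeneousLocalization.Away.val_mk, HomogeneousLocalization.val_zero,
          ← Localization.mk_zero 1, Localization.mk_eq_mk_iff, Localization.r_iff_exists] at hx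
        obtain ⟨⟨_, M, rfl⟩, hM⟩ := hx
        have hp' : MvPolynomial.X a ^ M * p ∈ RingHom.ker φ := by
          rw [RingHom.mem_ker, map_mul, map_pow]
          simpa using hM
        simpa using Ideal.mem_map_of_mem (dehom a) hp'
      · refine map_le_of_isHomogeneous (isHomogeneous_ker φ) _ fun N p hp hN => ?_
        rw [RingHom.mem_ker, h1 N p (by simpa using hN)]
        apply HomogeneousLocalization.val_injective
        rw [HomogeneousLocalization.Away.val_mk, HomogeneousLocalization.val_zero]
        have hp' : φ p = 0 := hp
        rw [hp', Localization.mk_zero]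
  have hcl : IsClosedImmersion (Proj.map φ hφ) := by
    refine IsZariskiLocalAtTarget.of_openCover (chartCover n R).openCover fun (a : n) => ?_
    change IsClosedImmersion (pullback.snd (Proj.map φ hφ) (chart a))
    obtain ⟨y, hy, ρ, h1, -, h3⟩ := hc a
    have hs : IsClosedImmersion (Spec.map (CommRingCat.ofHom ρ)) :=
      IsClosedImmersion.spec_of_surjective _ h1
    have : pullback.snd (Proj.map φ hφ) (chart a) =
        h3.flip.isoPullback.inv ≫ Spec.map (CommRingCat.ofHom ρ) := by simp
    rw [this]
    infer_instance
  refine ⟨hcl, eq_of_comap_chart_eq fun a => ?_⟩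
  obtain ⟨y, hy, ρ, -, h2, h3⟩ := hc a
  rw [comap_ker_of_isPullback _ _ _ _ h3, ker_SpecMap_eq_specIdeal, h2,
    comap_idealSheaf_chart (isHomogeneous_ker φ)]

end ProjMap

section Inf

variable {n R : Type} [CommRing R]

lemma specIdeal_inf {A : Type} [CommRing A] (I J : Ideal A) :
    specIdeal (I ⊓ J) = specIdeal I ⊓ specIdeal J := by
  refine eq_of_forall_le_iff fun K => ?_
  obtain ⟨K, rfl⟩ := specIdeal_surjective K
  simp [specIdeal_le_specIdeal]

lemma idealSheaf_inf (I J : Ideal (MvPolynomial n R)) :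
    idealSheaf (I ⊓ J) = idealSheaf I ⊓ idealSheaf J := by
  simp only [idealSheaf, sheafOfCharts_eq]
  rw [← iInf_inf_eq]
  refine iInf_congr fun a => ?_
  rw [IsLocalization.map_inf (Submonoid.powers (MvPolynomial.X a : MvPolynomial n R)),
    Ideal.comap_inf, specIdeal_inf, Scheme.IdealSheafData.map_inf]

lemma idealSheaf_top : idealSheaf (⊤ : Ideal (MvPolynomial n R)) = ⊤ := by
  simp only [idealSheaf, sheafOfCharts_eq, Ideal.map_top, Ideal.comap_top]
  refine iInf_eq_top.mpr fun a => ?_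
  obtain ⟨J, hJ⟩ := specIdeal_surjective (⊤ : (Spec (.of (ChartRing n R a))).IdealSheafData)
  have h : specIdeal (⊤ : Ideal (ChartRing n R a)) = ⊤ :=
    top_le_iff.mp (hJ ▸ specIdeal_le_specIdeal.mpr le_top)
  rw [h, Scheme.IdealSheafData.map_top]

/-- The ideal sheaf of a finite intersection of ideals. -/
lemma idealSheaf_iInf {ι : Type*} [Fintype ι] (I : ι → Ideal (MvPolynomial n R)) :
    idealSheaf (⨅ i, I i) = ⨅ i, idealSheaf (I i) := by
  classical
  rw [← Finset.inf_univ_eq_iInf, ← Finset.inf_univ_eq_iInf]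
  induction (Finset.univ : Finset ι) using Finset.induction_on with
  | empty => simpa using idealSheaf_top
  | insert i s _ ih => rw [Finset.inf_insert, Finset.inf_insert, idealSheaf_inf, ih]

end Inf

/-! ### Reduction, dimension and irreducibility -/

section Reduction

/-- A reduced closed subscheme with full support on which `π` has an inverse is the reduction. -/
lemma isIso_nilradical_subschemeι_comp {V P : Scheme.{0}} (r : P ⟶ V) (π : V ⟶ P)
    (h : r ≫ π = 𝟙 P) [IsClosedImmersion r] [Surjective r] [IsReduced P] :
    IsIso (V.nilradical.subschemeι ≫ π) := by
  -- The kernel consists of nilpotents since `r` is surjective …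
  have h1 : r.ker ≤ V.nilradical := by
    rw [← Scheme.IdealSheafData.vanishingIdeal_top,
      ← Scheme.IdealSheafData.le_support_iff_le_vanishingIdeal]
    intro x _
    obtain ⟨y, rfl⟩ := r.surjective x
    exact r.range_subset_ker_support ⟨y, rfl⟩
  -- … and contains all nilpotents since `P` is reduced.
  have h2 : V.nilradical ≤ r.ker := by
    rw [← Scheme.IdealSheafData.map_bot, Scheme.IdealSheafData.le_map_iff_comap_le, le_bot_iff,
      ← Scheme.IdealSheafData.support_eq_top_iff, Scheme.IdealSheafData.support_comap,
      Scheme.support_nilradical]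
    rfl
  have h3 : V.nilradical.subschemeι.ker = r.ker := by
    rw [Scheme.IdealSheafData.ker_subschemeι]
    exact le_antisymm h2 h1
  have h4 := IsClosedImmersion.isIso_lift V.nilradical.subschemeι r h3
  have h5 : V.nilradical.subschemeι =
      inv (IsClosedImmersion.lift V.nilradical.subschemeι r h3.le) ≫ r := by
    rw [IsIso.eq_inv_comp, IsClosedImmersion.lift_fac]
  rw [h5, Category.assoc, h, Category.comp_id]
  infer_instance

end Reduction

section Dimension

open TopologicalSpace Topology

/-- A common bound for the Krull dimensions of the members of an open cover bounds the Krull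
dimension of the space. -/
lemma topologicalKrullDim_le_of_cover {X : Type*} [TopologicalSpace X] {ι : Type*}
    {U : ι → Type*} [∀ i, TopologicalSpace (U i)] (f : ∀ i, U i → X)
    (hf : ∀ i, IsOpenEmbedding (f i)) (hU : ∀ x, ∃ i, x ∈ Set.range (f i)) {d : WithBot ℕ∞}
    (hd : ∀ i, topologicalKrullDim (U i) ≤ d) : topologicalKrullDim X ≤ d := by
  rw [topologicalKrullDim, Order.krullDim_eq_iSup_coheight]
  refine iSup_le fun Z => ?_
  obtain ⟨x, hx⟩ := Z.isIrreducible.nonempty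
  obtain ⟨i, y, rfl⟩ := hU x
  let e := IrreducibleCloseds.orderIsoOfIsOpenEmbedding (f i) (hf i)
  obtain ⟨W, hW⟩ := e.surjective ⟨Z, y, hx⟩
  have hW' : IrreducibleCloseds.map (f i) (hf i).continuous W = Z := congrArg Subtype.val hW
  rw [← hW', (hf i).coheight_map]
  exact (Order.coheight_le_krullDim W).trans (hd i)

end Dimension

section ProjectiveSpace

variable {n R : Type} [CommRing R]

instance [IsDomain R] (a : n) : IsDomain (ChartRing n R a) :=
  (chartEquiv a).toMulEquiv.isDomain _

instance [IsDomain R] : IsReduced (PP n R) := by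
  have : ∀ i, IsReduced ((chartCover n R).openCover.X i) := fun (a : n) =>
    inferInstanceAs (IsReduced (Spec (.of (ChartRing n R a))))
  exact IsReduced.of_openCover _ (chartCover n R).openCover

instance [IsDomain R] [Nonempty n] : IrreducibleSpace (PP n R) := by
  -- The zero ideal is the generic point.
  let x : ProjectiveSpectrum (grading n R) := ⟨⊥, Ideal.isPrime_bot, fun h => by
    obtain ⟨a⟩ := ‹Nonempty n›
    have := h (HomogeneousIdeal.mem_irrelevant_of_mem _ Nat.one_pos (X_mem a))
    exact MvPolynomial.X_ne_zero a this⟩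
  have hx : closure ({x} : Set (ProjectiveSpectrum (grading n R))) = Set.univ := by
    refine Set.eq_univ_of_forall fun y => ?_
    rw [← ProjectiveSpectrum.le_iff_mem_closure, ← ProjectiveSpectrum.as_ideal_le_as_ideal]
    exact bot_le
  have h : IsIrreducible (Set.univ : Set (ProjectiveSpectrum (grading n R))) :=
    hx ▸ isIrreducible_singleton.closure
  exact { isPreirreducible_univ := h.isPreirreducible, toNonempty := ⟨x⟩ }

lemma topologicalKrullDim_PP (k : Type) [Field k] (d : ℕ) :
    topologicalKrullDim (PP (Fin (d + 1)) k) = d := by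
  have hd : ∀ a : Fin (d + 1),
      topologicalKrullDim (Spec (.of (ChartRing (Fin (d + 1)) k a))) = d := fun a => by
    refine (PrimeSpectrum.topologicalKrullDim_eq_ringKrullDim _).trans ?_
    rw [ringKrullDim_eq_of_ringEquiv (chartEquiv a), MvPolynomial.ringKrullDim_of_isNoetherianRing]
    simp
  apply le_antisymm
  · refine topologicalKrullDim_le_of_cover (fun a : Fin (d + 1) => chart (R := k) a)
      (fun a => (chart a).isOpenEmbedding) (fun x => ?_) (fun a => (hd a).le)
    exact ⟨_, (chartCover (Fin (d + 1)) k).covers x⟩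
  · rw [← hd 0]
    exact (chart (R := k) (0 : Fin (d + 1))).isOpenEmbedding.isInducing.topologicalKrullDim_le

end ProjectiveSpace

/-! ### Monomials in shiftable variables -/

section Shift

variable {ι B K : Type} [CommRing K] (β : ι → B) (τ : ι → ℕ)

/-- The homomorphism `z_p ↦ t ^ τ(p) x_{β(p)}` to the polynomials in the `x_b` over `K[t]`. -/
def shiftHom : MvPolynomial ι K →+* MvPolynomial B (Polynomial K) :=
  MvPolynomial.eval₂Hom (MvPolynomial.C.comp Polynomial.C)
    (fun p => MvPolynomial.C (Polynomial.X ^ τ p) * MvPolynomial.X (β p))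

lemma shiftHom_X (p : ι) : shiftHom (K := K) β τ (MvPolynomial.X p) =
    MvPolynomial.C (Polynomial.X ^ τ p) * MvPolynomial.X (β p) := by simp [shiftHom]

lemma shiftHom_monomial (e : ι →₀ ℕ) (c : K) : shiftHom β τ (MvPolynomial.monomial e c) =
    MvPolynomial.monomial (e.mapDomain β) (Polynomial.monomial (Finsupp.weight τ e) c) := by
  induction e using Finsupp.induction_linear generalizing c with
  | zero => simp [shiftHom]
  | add f g hf hg =>
    have h : (MvPolynomial.monomial (f + g) c : MvPolynomial ι K) =
        MvPolynomial.monomial f c * MvPolynomial.monomial g 1 := by simp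
    rw [h, map_mul, hf, hg, MvPolynomial.monomial_mul, Polynomial.monomial_mul_monomial,
      Finsupp.mapDomain_add, map_add, mul_one]
  | single p k =>
    rw [shiftHom, MvPolynomial.coe_eval₂Hom, MvPolynomial.eval₂_monomial,
      Finsupp.prod_single_index (by simp), Finsupp.mapDomain_single, Finsupp.weight_single,
      MvPolynomial.monomial_eq, Finsupp.prod_single_index (by simp), mul_pow, ← map_pow,
      ← Polynomial.C_mul_X_pow_eq_monomial, map_mul]
    simp only [RingHom.comp_apply, smul_eq_mul]
    rw [← pow_mul, mul_comm (τ p) k]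
    ring

/-- The coefficient at `x ^ α t ^ k` of the image of `f` under `shiftHom`. -/
def shiftCoeff (f : MvPolynomial ι K) (α : B →₀ ℕ) (k : ℕ) : K :=
  ((shiftHom β τ f).coeff α).coeff k

open Classical in
lemma shiftCoeff_eq_sum (f : MvPolynomial ι K) (α : B →₀ ℕ) (k : ℕ) :
    shiftCoeff β τ f α k =
      ∑ e ∈ f.support with (e.mapDomain β, Finsupp.weight τ e) = (α, k), f.coeff e := by
  rw [shiftCoeff]
  conv_lhs => rw [f.as_sum]
  rw [map_sum, MvPolynomial.coeff_sum, Polynomial.finsetSum_coeff, Finset.sum_filter]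
  refine Finset.sum_congr rfl fun e _ => ?_
  rw [shiftHom_monomial, MvPolynomial.coeff_monomial]
  by_cases h : e.mapDomain β = α
  · simp [h, Polynomial.coeff_monomial]
  · simp [h]

variable {A : Type} [CommRing A] {Z : B → ℕ → A}
  (hZ : ∀ b b' j j', Z b (j + 1) * Z b' j' = Z b j * Z b' (j' + 1))

include hZ in
lemma shift_mul (b b' : B) (j j' : ℕ) : Z b j * Z b' j' = Z b (j + j') * Z b' 0 := by
  induction j' generalizing j with
  | zero => rfl
  | succ j' ih => rw [← hZ, ih]; congr 2; ring

include hZ in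
/-- In a product, the shifts can be moved to any one factor. -/
lemma shift_mul_prod (b : B) (j : ℕ) (e : ι →₀ ℕ) :
    Z b j * e.prod (fun p k => Z (β p) (τ p) ^ k) =
      Z b (j + Finsupp.weight τ e) * (e.mapDomain β).prod (fun b k => Z b 0 ^ k) := by
  induction e using Finsupp.induction_linear generalizing j with
  | zero => simp
  | add f g hf hg =>
    rw [Finsupp.prod_add_index' (by simp) (fun _ _ _ => pow_add _ _ _), ← mul_assoc, hf,
      mul_right_comm, hg, Finsupp.mapDomain_add,
      Finsupp.prod_add_index' (by simp) (fun _ _ _ => pow_add _ _ _), map_add, add_assoc]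
    ring
  | single p k =>
    rw [Finsupp.prod_single_index (by simp), Finsupp.mapDomain_single,
      Finsupp.prod_single_index (by simp), Finsupp.weight_single]
    induction k generalizing j with
    | zero => simp
    | succ k ih =>
      rw [pow_succ', ← mul_assoc, shift_mul hZ, mul_right_comm, ih, pow_succ', smul_eq_mul,
        smul_eq_mul, add_mul, one_mul, add_assoc, add_comm (τ p)]
      ring

lemma mem_support_mapDomain {e : ι →₀ ℕ} {p : ι} (hp : p ∈ e.support) :
    β p ∈ (e.mapDomain β).support := by
  have h : e = Finsupp.single p 1 + (e - Finsupp.single p 1) := by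
    rw [add_tsub_cancel_of_le]
    rw [Finsupp.single_le_iff]
    exact Nat.one_le_iff_ne_zero.mpr (Finsupp.mem_support_iff.mp hp)
  rw [Finsupp.mem_support_iff, h, Finsupp.mapDomain_add, Finsupp.mapDomain_single,
    Finsupp.add_apply, Finsupp.single_eq_same]
  omega

include hZ in
lemma prod_eq_of_mem_support {e : ι →₀ ℕ} {b : B} (hb : b ∈ (e.mapDomain β).support) :
    e.prod (fun p k => Z (β p) (τ p) ^ k) = Z b (Finsupp.weight τ e) *
      (e.mapDomain β - Finsupp.single b 1).prod (fun b k => Z b 0 ^ k) := by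
  classical
  obtain ⟨p, hp, rfl⟩ := Finset.mem_image.mp (Finsupp.mapDomain_support hb)
  have h : e = Finsupp.single p 1 + (e - Finsupp.single p 1) := by
    rw [add_tsub_cancel_of_le]
    rw [Finsupp.single_le_iff]
    exact Nat.one_le_iff_ne_zero.mpr (Finsupp.mem_support_iff.mp hp)
  generalize e - Finsupp.single p 1 = e' at h
  subst h
  rw [Finsupp.prod_add_index' (by simp) (fun _ _ _ => pow_add _ _ _),
    Finsupp.prod_single_index (by simp), pow_one, shift_mul_prod β τ hZ, Finsupp.mapDomain_add,
    Finsupp.mapDomain_single, add_tsub_cancel_left, map_add, Finsupp.weight_single, one_smul]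

include hZ in
lemma prod_eq_prod {e e' : ι →₀ ℕ} (h1 : e.mapDomain β = e'.mapDomain β)
    (h2 : Finsupp.weight τ e = Finsupp.weight τ e') :
    e.prod (fun p k => Z (β p) (τ p) ^ k) = e'.prod (fun p k => Z (β p) (τ p) ^ k) := by
  by_cases h : e.mapDomain β = 0
  · have h0 : ∀ e : ι →₀ ℕ, e.mapDomain β = 0 → e = 0 := fun e he => by
      rw [← Finsupp.support_eq_empty, Finset.eq_empty_iff_forall_notMem]
      intro p hp
      simpa [he] using mem_support_mapDomain β hp
    rw [h0 e h, h0 e' (h1 ▸ h)]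
  · obtain ⟨b, hb⟩ := Finsupp.support_nonempty_iff.mpr h
    rw [prod_eq_of_mem_support β τ hZ hb, prod_eq_of_mem_support β τ hZ (h1 ▸ hb), h1, h2]

include hZ in
/-- If `z_p ↦ Z (β p) (τ p)` and shifts can be moved between factors, then the value of a
polynomial depends only on its image under `shiftHom`; more precisely, only on the coefficients at
those `x ^ α t ^ k` for which `Z b k ≠ 0` for all `b` in `α`. -/
lemma eval_eq_zero_of_shiftCoeff (α : K →+* A) (f : MvPolynomial ι K)
    (hf : ∀ e ∈ f.support, shiftCoeff β τ f (e.mapDomain β) (Finsupp.weight τ e) = 0 ∨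
      ∃ b ∈ (e.mapDomain β).support, Z b (Finsupp.weight τ e) = 0) :
    MvPolynomial.eval₂Hom α (fun p => Z (β p) (τ p)) f = 0 := by
  classical
  conv_lhs => rw [f.as_sum]
  rw [map_sum, ← Finset.sum_fiberwise_of_maps_to
    (t := f.support.image fun e => (e.mapDomain β, Finsupp.weight τ e))
    (fun e he => Finset.mem_image_of_mem _ he)]
  refine Finset.sum_eq_zero fun x hx => ?_
  obtain ⟨e, he, rfl⟩ := Finset.mem_image.mp hx
  have h : ∀ e' ∈ f.support.filter
      (fun e' => (e'.mapDomain β, Finsupp.weight τ e') = (e.mapDomain β, Finsupp.weight τ e)),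
      MvPolynomial.eval₂Hom α (fun p => Z (β p) (τ p)) (MvPolynomial.monomial e' (f.coeff e')) =
        α (f.coeff e') * e.prod (fun p k => Z (β p) (τ p) ^ k) := fun e' he' => by
    have he'' := Prod.ext_iff.mp (Finset.mem_filter.mp he').2
    rw [MvPolynomial.coe_eval₂Hom, MvPolynomial.eval₂_monomial,
      prod_eq_prod β τ hZ he''.1 he''.2]
  rw [Finset.sum_congr rfl h, ← Finset.sum_mul, ← map_sum, ← shiftCoeff_eq_sum]
  rcases hf e he with h1 | ⟨b, hb, h1⟩
  · rw [h1, map_zero, zero_mul]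
  · rw [prod_eq_of_mem_support β τ hZ hb, h1, zero_mul, mul_zero]

end Shift

/-! ### Ideals of truncated shifts -/

section ShiftIdeal

lemma radical_span_pow {A : Type} [CommRing A] {x : A} (hx : Prime x) {n : ℕ} (hn : n ≠ 0) :
    (Ideal.span {x ^ n}).radical = Ideal.span {x} := by
  rw [← Ideal.span_singleton_pow, Ideal.radical_pow _ hn,
    ((Ideal.span_singleton_prime hx.ne_zero).mpr hx).radical]

lemma isPrimary_span_pow {A : Type} [CommRing A] [IsDomain A] {x : A} (hx : Prime x) {n : ℕ}
    (hn : n ≠ 0) : (Ideal.span {x ^ n}).IsPrimary := by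
  rw [Ideal.isPrimary_iff, radical_span_pow hx hn]
  refine ⟨fun h => hx.not_isUnit ?_, fun {a b} h => ?_⟩
  · rwa [Ideal.span_singleton_eq_top, isUnit_pow_iff hn] at h
  · rw [Ideal.mem_span_singleton] at h ⊢
    rw [Ideal.mem_span_singleton]
    by_cases hb : x ∣ b
    · exact Or.inr hb
    · exact Or.inl (hx.pow_dvd_of_dvd_mul_right n hb h)

variable {ι B N K : Type} [CommRing K] (β : ι → B) (τ : ι → ℕ) {inj : N → B}
  (hinj : Function.Injective inj)

/-- The homomorphism to `K[t][y_a | a ∈ N]` sending `z_p` to `t ^ τ(p) y_a` if `β p = inj a`, and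
to `0` if `β p` is not in the range of `inj`. -/
def blockHom : MvPolynomial ι K →+* MvPolynomial N (Polynomial K) :=
  (MvPolynomial.killCompl hinj).toRingHom.comp (shiftHom β τ)

lemma blockHom_X (p : ι) (a : N) (h : β p = inj a) :
    blockHom (K := K) β τ hinj (MvPolynomial.X p) =
      MvPolynomial.C (Polynomial.X ^ τ p) * MvPolynomial.X a := by
  have h1 : MvPolynomial.killCompl hinj (MvPolynomial.X (inj a) : MvPolynomial B (Polynomial K)) =
      MvPolynomial.X a := by
    rw [← MvPolynomial.rename_X inj, MvPolynomial.killCompl_rename_app]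
  change MvPolynomial.killCompl hinj (shiftHom β τ (MvPolynomial.X p)) = _
  rw [shiftHom_X, map_mul, MvPolynomial.killCompl_C, h, h1]

lemma blockHom_X_eq_zero (p : ι) (h : β p ∉ Set.range inj) :
    blockHom (K := K) β τ hinj (MvPolynomial.X p) = 0 := by
  change MvPolynomial.killCompl hinj (shiftHom β τ (MvPolynomial.X p)) = _
  rw [shiftHom_X, map_mul, MvPolynomial.killCompl, MvPolynomial.aeval_X, dif_neg h, mul_zero]

lemma blockHom_C (c : K) : blockHom β τ hinj (MvPolynomial.C c) =
    MvPolynomial.C (Polynomial.C c) := by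
  change MvPolynomial.killCompl hinj (shiftHom β τ (MvPolynomial.C c)) = _
  rw [shiftHom, MvPolynomial.coe_eval₂Hom, MvPolynomial.eval₂_C, RingHom.comp_apply,
    MvPolynomial.killCompl_C]

/-- The ideal of the polynomials whose image under `blockHom` vanishes modulo `t ^ n`. -/
def shiftIdeal (n : ℕ) : Ideal (MvPolynomial ι K) :=
  (Ideal.span {MvPolynomial.C (Polynomial.X ^ n)}).comap (blockHom β τ hinj)

lemma mem_shiftIdeal_iff_dvd {n : ℕ} {f : MvPolynomial ι K} : f ∈ shiftIdeal β τ hinj n ↔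
    MvPolynomial.C (Polynomial.X ^ n) ∣ blockHom β τ hinj f := by
  rw [shiftIdeal, Ideal.mem_comap, Ideal.mem_span_singleton]

lemma mem_shiftIdeal {n : ℕ} {f : MvPolynomial ι K} : f ∈ shiftIdeal β τ hinj n ↔
    ∀ α : B →₀ ℕ, (∀ b ∈ α.support, b ∈ Set.range inj) → ∀ k < n, shiftCoeff β τ f α k = 0 := by
  rw [mem_shiftIdeal_iff_dvd, MvPolynomial.C_dvd_iff_dvd_coeff]
  simp_rw [Polynomial.X_pow_dvd_iff]
  have h : ∀ α : N →₀ ℕ, (blockHom β τ hinj f).coeff α =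
      (shiftHom β τ f).coeff (α.mapDomain inj) := fun α => MvPolynomial.coeff_killCompl ..
  simp_rw [h]
  constructor
  · intro h α hα k hk
    rw [shiftCoeff, ← Finsupp.mapDomain_comapDomain inj hinj α (fun b hb => hα b hb)]
    exact h _ k hk
  · intro h α k hk
    refine h _ (fun b hb => ?_) k hk
    classical
    obtain ⟨a, -, rfl⟩ := Finset.mem_image.mp (Finsupp.mapDomain_support hb)
    exact ⟨a, rfl⟩

lemma X_mem_shiftIdeal_of_le {n : ℕ} {p : ι} (h : n ≤ τ p) :
    (MvPolynomial.X p : MvPolynomial ι K) ∈ shiftIdeal β τ hinj n := by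
  rw [mem_shiftIdeal_iff_dvd]
  by_cases hp : β p ∈ Set.range inj
  · obtain ⟨a, ha⟩ := hp
    rw [blockHom_X β τ hinj p a ha.symm]
    exact (map_dvd _ (pow_dvd_pow _ h)).mul_right _
  · rw [blockHom_X_eq_zero β τ hinj p hp]
    exact dvd_zero _

lemma X_mem_shiftIdeal_of_notMem {n : ℕ} {p : ι} (h : β p ∉ Set.range inj) :
    (MvPolynomial.X p : MvPolynomial ι K) ∈ shiftIdeal β τ hinj n := by
  rw [mem_shiftIdeal_iff_dvd, blockHom_X_eq_zero β τ hinj p h]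
  exact dvd_zero _

lemma X_notMem_shiftIdeal [Nontrivial K] {n : ℕ} {p : ι} (h : τ p < n)
    (hp : β p ∈ Set.range inj) :
    (MvPolynomial.X p : MvPolynomial ι K) ∉ shiftIdeal β τ hinj n := by
  classical
  obtain ⟨a, ha⟩ := hp
  rw [mem_shiftIdeal_iff_dvd, blockHom_X β τ hinj p a ha.symm, MvPolynomial.C_dvd_iff_dvd_coeff]
  intro h1
  have h2 := h1 (Finsupp.single a 1)
  rw [MvPolynomial.coeff_C_mul, MvPolynomial.coeff_X, if_pos rfl, mul_one,
    Polynomial.X_pow_dvd_iff] at h2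
  simpa using h2 _ h

variable [IsDomain K]

lemma prime_C_X : Prime (MvPolynomial.C Polynomial.X : MvPolynomial N (Polynomial K)) :=
  (MvPolynomial.prime_C_iff N).mpr Polynomial.prime_X

lemma isPrimary_shiftIdeal {n : ℕ} (hn : n ≠ 0) :
    (shiftIdeal (K := K) β τ hinj n).IsPrimary := by
  rw [shiftIdeal, map_pow]
  exact (isPrimary_span_pow prime_C_X hn).comap _

lemma radical_shiftIdeal {n : ℕ} (hn : n ≠ 0) :
    (shiftIdeal (K := K) β τ hinj n).radical = shiftIdeal β τ hinj 1 := by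
  rw [shiftIdeal, map_pow, ← Ideal.comap_radical, radical_span_pow prime_C_X hn, shiftIdeal,
    pow_one]

end ShiftIdeal

/-! ### The ideals of the Higgs Grassmannian and of its components -/

section JordanIdeals

variable {s : ℕ}

/-- The Jordan blocks: `⟨w, k⟩` is the `k`-th block of size `i w`. -/
abbrev Blk (m : Fin s → ℕ) : Type := Σ w : Fin s, Fin (m w)

variable {i m : Fin s → ℕ}

/-- The Jordan block that contains an index. -/
def blk (p : Idx i m) : Blk m := ⟨p.1, p.2.1⟩

/-- The position of an index in its Jordan block. -/
def pos (p : Idx i m) : ℕ := p.2.2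

lemma pos_lt (p : Idx i m) : pos p < i (blk p).1 := p.2.2.2

/-- The coordinate at position `j` of the block `b`, and `0` beyond the end of the block. -/
def zvar (i : Fin s → ℕ) (R : Type) [CommRing R] (b : Blk m) (j : ℕ) : MvPolynomial (Idx i m) R :=
  if h : j < i b.1 then MvPolynomial.X ⟨b.1, b.2, ⟨j, h⟩⟩ else 0

lemma zvar_blk_pos {R : Type} [CommRing R] (p : Idx i m) :
    zvar i R (blk p) (pos p) = MvPolynomial.X p := dif_pos (pos_lt p)

lemma zvar_of_le {R : Type} [CommRing R] {b : Blk m} {j : ℕ} (h : i b.1 ≤ j) :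
    zvar i R b j = 0 := dif_neg h.not_gt

lemma zvar_of_lt {R : Type} [CommRing R] {b : Blk m} {j : ℕ} (h : j < i b.1) :
    zvar i R b j = MvPolynomial.X ⟨b.1, b.2, ⟨j, h⟩⟩ := dif_pos h

lemma sum_jordan {R : Type} [CommRing R] (lam : R) (q : Idx i m) :
    ∑ k, MvPolynomial.X k * MvPolynomial.C (jordan i m lam q k) =
      MvPolynomial.C lam * MvPolynomial.X q + zvar i R (blk q) (pos q + 1) := by
  classical
  have h : ∀ k : Idx i m, (MvPolynomial.X k * MvPolynomial.C (jordan i m lam q k) :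
      MvPolynomial (Idx i m) R) = (if q = k then MvPolynomial.C lam * MvPolynomial.X q else 0) +
        if q.1 = k.1 ∧ (q.2.1 : ℕ) = k.2.1 ∧ (q.2.2 : ℕ) + 1 = k.2.2 then MvPolynomial.X k
          else 0 := by
    intro k
    rw [jordan]
    by_cases hk : q = k
    · subst hk
      simp [mul_comm]
    · rw [if_neg hk, if_neg hk, zero_add]
      split_ifs <;> simp
  rw [Finset.sum_congr rfl fun k _ => h k, Finset.sum_add_distrib, Finset.sum_ite_eq,
    if_pos (Finset.mem_univ _)]
  congr 1
  by_cases hq : pos q + 1 < i (blk q).1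
  · rw [zvar_of_lt hq, Finset.sum_eq_single (⟨(blk q).1, (blk q).2, ⟨pos q + 1, hq⟩⟩ : Idx i m),
      if_pos ⟨rfl, rfl, rfl⟩]
    · intro k _ hk
      rw [if_neg]
      rintro ⟨h1, h2, h3⟩
      apply hk
      obtain ⟨w, k1, j1⟩ := k
      obtain ⟨w', k2, j2⟩ := q
      obtain rfl : w' = w := h1
      obtain rfl : k2 = k1 := Fin.ext h2
      exact congrArg _ (Prod.ext rfl (Fin.ext h3.symm))
    · exact fun h => (h (Finset.mem_univ _)).elim
  · rw [zvar_of_le (not_lt.mp hq)]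
    refine Finset.sum_eq_zero fun k _ => if_neg ?_
    rintro ⟨h1, -, h3⟩
    apply hq
    have h2 := k.2.2.2
    rw [← h3] at h2
    exact h2.trans_eq (congrArg i h1.symm)

/-- The quadrics that define the Higgs Grassmannian: the eigenvalue cancels. -/
lemma higgsIdeal_jordan {R : Type} [CommRing R] (lam : R) : higgsIdeal (jordan i m lam) =
    Ideal.span (Set.range fun p : Idx i m × Idx i m =>
      zvar i R (blk p.2) (pos p.2 + 1) * MvPolynomial.X p.1 -
        MvPolynomial.X p.2 * zvar i R (blk p.1) (pos p.1 + 1)) := by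
  rw [higgsIdeal]
  congr 2
  funext p
  have h : ∀ k : Idx i m, (MvPolynomial.X k * (MvPolynomial.C (jordan i m lam p.2 k) *
      MvPolynomial.X p.1 - MvPolynomial.C (jordan i m lam p.1 k) * MvPolynomial.X p.2) :
        MvPolynomial (Idx i m) R) =
      MvPolynomial.X k * MvPolynomial.C (jordan i m lam p.2 k) * MvPolynomial.X p.1 -
        MvPolynomial.X k * MvPolynomial.C (jordan i m lam p.1 k) * MvPolynomial.X p.2 := by
    intro k; ring
  simp only [h]
  rw [Finset.sum_sub_distrib, ← Finset.sum_mul, ← Finset.sum_mul, sum_jordan, sum_jordan]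
  ring

section BlockHom

variable {N K : Type} [CommRing K] {inj : N → Blk m} (hinj : Function.Injective inj)

lemma dvd_blockHom_X (p : Idx i m) : MvPolynomial.C (Polynomial.X ^ pos p) ∣
    blockHom (K := K) blk pos hinj (MvPolynomial.X p) := by
  rw [← mem_shiftIdeal_iff_dvd]
  exact X_mem_shiftIdeal_of_le _ _ _ le_rfl

lemma blockHom_X_succ {p q : Idx i m} (h1 : blk p = blk q) (h2 : pos q = pos p + 1) :
    blockHom (K := K) blk pos hinj (MvPolynomial.X q) =
      MvPolynomial.C Polynomial.X * blockHom blk pos hinj (MvPolynomial.X p) := by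
  by_cases h : blk q ∈ Set.range inj
  · obtain ⟨a, ha⟩ := h
    rw [blockHom_X _ _ hinj q a ha.symm, blockHom_X _ _ hinj p a (h1.trans ha.symm), h2, pow_succ',
      map_mul, mul_assoc]
  · rw [blockHom_X_eq_zero _ _ hinj q h, blockHom_X_eq_zero _ _ hinj p (h1 ▸ h), mul_zero]

variable {v : Fin s} (hr : ∀ b, b ∈ Set.range inj ↔ b.1 ≤ v) (hi : StrictAnti i)

include hr hi in
lemma dvd_blockHom_zvar_sub (q : Idx i m) : MvPolynomial.C (Polynomial.X ^ i v) ∣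
    blockHom (K := K) blk pos hinj (zvar i K (blk q) (pos q + 1)) -
      MvPolynomial.C Polynomial.X * blockHom blk pos hinj (MvPolynomial.X q) := by
  by_cases h : pos q + 1 < i (blk q).1
  · rw [zvar_of_lt h, blockHom_X_succ hinj (p := q) (q := ⟨_, (blk q).2, ⟨_, h⟩⟩) rfl rfl,
      sub_self]
    exact dvd_zero _
  · rw [zvar_of_le (not_lt.mp h), map_zero]
    refine dvd_sub (dvd_zero _) ?_
    by_cases hq : (blk q).1 ≤ v
    · refine (map_dvd _ (pow_dvd_pow _ ((hi.antitone hq).trans (not_lt.mp h)))).trans ?_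
      rw [pow_succ', map_mul]
      exact mul_dvd_mul_left _ (dvd_blockHom_X hinj q)
    · rw [blockHom_X_eq_zero _ _ hinj q (mt (hr _).mp hq), mul_zero]
      exact dvd_zero _

include hr hi in
lemma higgsIdeal_le_shiftIdeal (lam : K) :
    higgsIdeal (jordan i m lam) ≤ shiftIdeal blk pos hinj (i v) := by
  rw [higgsIdeal_jordan, Ideal.span_le]
  rintro _ ⟨⟨p, q⟩, rfl⟩
  rw [SetLike.mem_coe, mem_shiftIdeal_iff_dvd, map_sub, map_mul, map_mul]
  have h1 := dvd_blockHom_zvar_sub (K := K) hinj hr hi p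
  have h2 := dvd_blockHom_zvar_sub (K := K) hinj hr hi q
  have h3 := dvd_sub (h2.mul_left (blockHom blk pos hinj (MvPolynomial.X p)))
    (h1.mul_left (blockHom blk pos hinj (MvPolynomial.X q)))
  refine h3.trans (dvd_of_eq ?_)
  ring

end BlockHom

lemma zvar_mul_sub_mem_higgsIdeal {R : Type} [CommRing R] (lam : R) (b b' : Blk m) (j j' : ℕ) :
    zvar i R b (j + 1) * zvar i R b' j' - zvar i R b j * zvar i R b' (j' + 1) ∈
      higgsIdeal (jordan i m lam) := by
  by_cases h : j < i b.1
  · by_cases h' : j' < i b'.1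
    · rw [zvar_of_lt h, zvar_of_lt h', higgsIdeal_jordan]
      exact Ideal.subset_span ⟨(⟨b'.1, b'.2, ⟨j', h'⟩⟩, ⟨b.1, b.2, ⟨j, h⟩⟩), rfl⟩
    · rw [zvar_of_le (not_lt.mp h'), zvar_of_le ((not_lt.mp h').trans j'.le_succ), mul_zero,
        mul_zero, sub_zero]
      exact zero_mem _
  · rw [zvar_of_le (not_lt.mp h), zvar_of_le ((not_lt.mp h).trans j.le_succ), zero_mul,
      zero_mul, sub_zero]
    exact zero_mem _

/-- For a polynomial in the intersection, a monomial `x ^ α t ^ k` can only occur in its image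
under `shiftHom` if `k` is at least the size of the smallest block that occurs in `α`; a shift by
`k` of a variable of that block is zero. -/
lemma higgsIdeal_eq_iInf {K : Type} [CommRing K] (hs : 1 ≤ s) (hi : StrictAnti i)
    (hipos : ∀ v, 0 < i v) (lam : K) : higgsIdeal (jordan i m lam) =
      ⨅ v, shiftIdeal blk pos (Subtype.val_injective (p := fun b : Blk m => b.1 ≤ v)) (i v) := by
  refine le_antisymm (le_iInf fun v => higgsIdeal_le_shiftIdeal _ (by simp) hi lam) fun f hf => ?_
  rw [Submodule.mem_iInf] at hf
  simp only [mem_shiftIdeal, Subtype.range_coe_subtype, Set.mem_ofPred_eq] at hf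
  let I := higgsIdeal (jordan i m lam)
  let Z : Blk m → ℕ → MvPolynomial (Idx i m) K ⧸ I := fun b j =>
    Ideal.Quotient.mk I (zvar i K b j)
  have hZ : ∀ b b' j j', Z b (j + 1) * Z b' j' = Z b j * Z b' (j' + 1) := fun b b' j j' => by
    simp only [Z, ← map_mul]
    exact Ideal.Quotient.eq.mpr (zvar_mul_sub_mem_higgsIdeal lam b b' j j')
  have hmk : Ideal.Quotient.mk I = MvPolynomial.eval₂Hom
      ((Ideal.Quotient.mk I).comp MvPolynomial.C) (fun p => Z (blk p) (pos p)) := by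
    ext p
    · simp
    · simp [Z, zvar_blk_pos]
  rw [← Ideal.Quotient.eq_zero_iff_mem (I := I), hmk]
  refine eval_eq_zero_of_shiftCoeff blk pos hZ _ f fun e he => ?_
  by_cases h : (e.mapDomain blk).support.Nonempty
  · obtain ⟨b, hb, hmax⟩ := Finset.exists_max_image _ Sigma.fst h
    by_cases hk : Finsupp.weight pos e < i b.1
    · exact Or.inl (hf b.1 _ hmax _ hk)
    · refine Or.inr ⟨b, hb, ?_⟩
      simp only [Z]
      rw [zvar_of_le (not_lt.mp hk), map_zero]
  · rw [Finset.not_nonempty_iff_eq_empty] at h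
    have he0 : e = 0 := by
      rw [← Finsupp.support_eq_empty, Finset.eq_empty_iff_forall_notMem]
      intro p hp
      simpa [h] using mem_support_mapDomain blk hp
    refine Or.inl (hf ⟨0, hs⟩ _ (by simp [h]) _ ?_)
    rw [he0, map_zero]
    exact hipos _

section Component

variable {N : Type} {inj : N → Blk m} (hinj : Function.Injective inj)
  {v : Fin s} (hr : ∀ b, b ∈ Set.range inj ↔ b.1 ≤ v) (hi : StrictAnti i)

lemma mem_blockSet_iff {w : Fin s} {k : Fin (m w)} {p : Idx i m} :
    p ∈ blockSet i m v w k ↔ blk p = ⟨w, k⟩ ∧ pos p < i v := by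
  constructor
  · rintro ⟨j, hj, rfl⟩
    exact ⟨rfl, hj⟩
  · rintro ⟨h, h'⟩
    obtain ⟨w', k', j'⟩ := p
    obtain rfl : w' = w := congrArg Sigma.fst h
    obtain rfl : k' = k := by simpa [blk] using h
    exact ⟨j', h', rfl⟩

lemma mem_LL_iff {p : Idx i m} : p ∈ LL i m v ↔ ¬ ((blk p).1 ≤ v ∧ pos p < i v) := by
  simp only [LL, Set.mem_ofPred_eq, mem_blockSet_iff]
  constructor
  · exact fun h ⟨h1, h2⟩ => h _ (blk p).2 h1 ⟨rfl, h2⟩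
  · rintro h w k hw ⟨h1, h2⟩
    exact h ⟨h1 ▸ hw, h2⟩

lemma mem_BB_iff {p : Idx i m} :
    p ∈ BB i m v ↔ (blk p).1 ≤ v ∧ pos p < i v ∧ pos p ≠ 0 := by
  simp only [BB, Set.mem_ofPred_eq, mem_blockSet_iff]
  constructor
  · rintro ⟨w, k, hw, ⟨h1, h2⟩, h3⟩
    exact ⟨h1 ▸ hw, h2, h3⟩
  · rintro ⟨h1, h2, h3⟩
    exact ⟨_, (blk p).2, h1, ⟨rfl, h2⟩, h3⟩

lemma mem_CC_iff {p : Idx i m} : p ∈ CC i m v ↔ (blk p).1 ≤ v ∧ pos p + 1 = i v := by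
  simp only [CC, Set.mem_ofPred_eq, mem_blockSet_iff]
  constructor
  · rintro ⟨w, k, hw, ⟨h1, h2⟩, h3⟩
    exact ⟨h1 ▸ hw, h3⟩
  · rintro ⟨h1, h3⟩
    exact ⟨_, (blk p).2, h1, ⟨rfl, by omega⟩, h3⟩

lemma mem_columns_iff {c : Idx i m × Idx i m} : c ∈ columns i m v ↔
    (blk c.1).1 ≤ v ∧ blk c.2 = blk c.1 ∧ pos c.2 = pos c.1 + 1 ∧ pos c.2 < i v := by
  simp only [columns, Set.mem_ofPred_eq, mem_blockSet_iff]
  constructor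
  · rintro ⟨w, k, hw, ⟨h1, h2⟩, ⟨h3, h4⟩, h5⟩
    exact ⟨h1 ▸ hw, h3.trans h1.symm, h5, h4⟩
  · rintro ⟨h1, h2, h3, h4⟩
    exact ⟨_, (blk c.1).2, h1, ⟨rfl, by omega⟩, ⟨h2, h4⟩, h3⟩

lemma det_colMatrix (c c' : columns i m v) : ((colMatrix i m v).submatrix id ![c, c']).det =
    MvPolynomial.X c.1.1 * MvPolynomial.X c'.1.2 -
      MvPolynomial.X c'.1.1 * MvPolynomial.X c.1.2 := by
  rw [Matrix.det_fin_two]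
  rfl

include hr in
lemma componentIdeal_le_shiftIdeal :
    componentIdeal i m v ≤ shiftIdeal blk pos hinj (i v) := by
  refine sup_le (sup_le ?_ ?_) ?_ <;> refine Ideal.span_le.mpr ?_
  · rintro _ ⟨p, hp, rfl⟩
    rw [mem_LL_iff] at hp
    by_cases h : (blk p).1 ≤ v
    · exact X_mem_shiftIdeal_of_le _ _ _ (not_lt.mp fun h' => hp ⟨h, h'⟩)
    · exact X_mem_shiftIdeal_of_notMem _ _ _ (mt (hr _).mp h)
  · rintro _ ⟨p, hp, q, hq, rfl⟩
    rw [mem_BB_iff] at hp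
    rw [mem_CC_iff] at hq
    rw [SetLike.mem_coe, mem_shiftIdeal_iff_dvd, map_mul]
    refine (map_dvd MvPolynomial.C (pow_dvd_pow Polynomial.X
      (show i v ≤ pos p + pos q by omega))).trans ?_
    rw [pow_add, map_mul]
    exact mul_dvd_mul (dvd_blockHom_X hinj p) (dvd_blockHom_X hinj q)
  · rintro _ ⟨⟨c, c'⟩, rfl⟩
    dsimp only
    obtain ⟨-, h1, h2, -⟩ := mem_columns_iff.mp c.2
    obtain ⟨-, h1', h2', -⟩ := mem_columns_iff.mp c'.2
    rw [det_colMatrix, SetLike.mem_coe, mem_shiftIdeal_iff_dvd, map_sub, map_mul, map_mul,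
      blockHom_X_succ hinj h1.symm h2, blockHom_X_succ hinj h1'.symm h2']
    refine (dvd_zero _).trans (dvd_of_eq ?_)
    ring

/-- The coordinate at position `j` of the block `b`, made `0` for the coordinates with index in
`LL`, as an element of the homogeneous coordinate ring of the component. -/
def zcomp (i m : Fin s → ℕ) (v : Fin s) (b : Blk m) (j : ℕ) :
    MvPolynomial (Idx i m) ℂ ⧸ componentIdeal i m v :=
  open Classical in
  if b.1 ≤ v ∧ j < i v then Ideal.Quotient.mk _ (zvar i ℂ b j) else 0

include hi in
lemma zcomp_of_lt {b : Blk m} {j : ℕ} (hb : b.1 ≤ v) (hj : j < i v) : zcomp i m v b j =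
    Ideal.Quotient.mk _ (MvPolynomial.X ⟨b.1, b.2, ⟨j, hj.trans_le (hi.antitone hb)⟩⟩) := by
  rw [zcomp, if_pos ⟨hb, hj⟩, zvar_of_lt]

lemma zcomp_of_le {b : Blk m} {j : ℕ} (hj : i v ≤ j) : zcomp i m v b j = 0 :=
  if_neg fun h => hj.not_gt h.2

lemma zcomp_of_not_le {b : Blk m} {j : ℕ} (hb : ¬ b.1 ≤ v) : zcomp i m v b j = 0 :=
  if_neg fun h => hb h.1

include hi in
/-- The product of a coordinate in `BB` and one in `CC` is a minor of the matrix `M_v` extended by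
columns `(z_c, 0)`, `c ∈ CC`. -/
lemma zcomp_mul_of_lt (b b' : Blk m) {j : ℕ} (j' : ℕ) (hj : j + 1 < i v) :
    zcomp i m v b (j + 1) * zcomp i m v b' j' = zcomp i m v b j * zcomp i m v b' (j' + 1) := by
  by_cases hb : b.1 ≤ v
  · by_cases hb' : b'.1 ≤ v
    · by_cases hj' : j' + 1 < i v
      · rw [zcomp_of_lt hi hb hj, zcomp_of_lt hi hb (j.lt_succ_self.trans hj),
          zcomp_of_lt hi hb' hj', zcomp_of_lt hi hb' (j'.lt_succ_self.trans hj'), ← map_mul,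
          ← map_mul, eq_comm, Ideal.Quotient.eq]
        refine Ideal.mem_sup_right (Ideal.subset_span ⟨(⟨(_, _), ?_⟩, ⟨(_, _), ?_⟩),
          (det_colMatrix _ _).trans (congrArg₂ _ rfl (mul_comm _ _))⟩)
        · exact mem_columns_iff.mpr ⟨hb, rfl, rfl, hj⟩
        · exact mem_columns_iff.mpr ⟨hb', rfl, rfl, hj'⟩
      · rw [zcomp_of_le (b := b') (not_lt.mp hj'), mul_zero]
        by_cases hj'' : j' < i v
        · rw [zcomp_of_lt hi hb hj, zcomp_of_lt hi hb' hj'', ← map_mul,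
            Ideal.Quotient.eq_zero_iff_mem]
          refine Ideal.mem_sup_left (Ideal.mem_sup_right (Ideal.subset_span ⟨_, ?_, _, ?_, rfl⟩))
          · exact mem_BB_iff.mpr ⟨hb, hj, j.succ_ne_zero⟩
          · exact mem_CC_iff.mpr ⟨hb', show j' + 1 = i v by omega⟩
        · rw [zcomp_of_le (b := b') (not_lt.mp hj''), mul_zero]
    · rw [zcomp_of_not_le hb', zcomp_of_not_le hb', mul_zero, mul_zero]
  · rw [zcomp_of_not_le hb, zcomp_of_not_le hb, zero_mul, zero_mul]

include hi in
lemma zcomp_mul (b b' : Blk m) (j j' : ℕ) :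
    zcomp i m v b (j + 1) * zcomp i m v b' j' = zcomp i m v b j * zcomp i m v b' (j' + 1) := by
  by_cases hj : j + 1 < i v
  · exact zcomp_mul_of_lt hi b b' j' hj
  by_cases hj' : j' + 1 < i v
  · rw [mul_comm, ← zcomp_mul_of_lt hi b' b j hj', mul_comm]
  rw [zcomp_of_le (not_lt.mp hj), zcomp_of_le (not_lt.mp hj'), zero_mul, mul_zero]

include hr hi in
lemma componentIdeal_eq_shiftIdeal (hv : 0 < i v) :
    componentIdeal i m v = shiftIdeal blk pos hinj (i v) := by
  refine le_antisymm (componentIdeal_le_shiftIdeal hinj hr) fun f hf => ?_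
  rw [mem_shiftIdeal] at hf
  simp only [hr] at hf
  have hmk : Ideal.Quotient.mk (componentIdeal i m v) = MvPolynomial.eval₂Hom
      ((Ideal.Quotient.mk _).comp MvPolynomial.C) (fun p => zcomp i m v (blk p) (pos p)) := by
    ext p
    · simp
    · rw [MvPolynomial.coe_eval₂Hom, MvPolynomial.eval₂_X]
      by_cases h : (blk p).1 ≤ v ∧ pos p < i v
      · rw [zcomp, if_pos h, zvar_blk_pos]
      · rw [zcomp, if_neg h, Ideal.Quotient.eq_zero_iff_mem]
        exact Ideal.mem_sup_left (Ideal.mem_sup_left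
          (Ideal.subset_span ⟨p, mem_LL_iff.mpr h, rfl⟩))
  rw [← Ideal.Quotient.eq_zero_iff_mem, hmk]
  refine eval_eq_zero_of_shiftCoeff blk pos (zcomp_mul hi) _ f fun e he => ?_
  by_cases h : ∀ b ∈ (e.mapDomain blk).support, b.1 ≤ v
  · by_cases hk : Finsupp.weight pos e < i v
    · exact Or.inl (hf _ h _ hk)
    · have he0 : e ≠ 0 := by
        rintro rfl
        exact hk (by simpa using hv)
      obtain ⟨p, hp⟩ := Finsupp.support_nonempty_iff.mpr he0
      exact Or.inr ⟨_, mem_support_mapDomain blk hp, zcomp_of_le (not_lt.mp hk)⟩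
  · push Not at h
    obtain ⟨b, hb, hbv⟩ := h
    exact Or.inr ⟨b, hb, zcomp_of_not_le hbv.not_ge⟩

end Component

end JordanIdeals

/-! ### The primary decomposition -/

section PrimaryDecomposition

variable {s : ℕ} {i m : Fin s → ℕ} (hi : StrictAnti i) (hipos : ∀ v, 0 < i v) (hm : ∀ v, 0 < m v)

include hi hipos in
lemma componentIdeal_eq (v : Fin s) : componentIdeal i m v =
    shiftIdeal blk pos (Subtype.val_injective (p := fun b : Blk m => b.1 ≤ v)) (i v) :=
  componentIdeal_eq_shiftIdeal _ (by simp) hi (hipos v)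

include hi hipos in
lemma higgsIdeal_eq_iInf_componentIdeal (hs : 1 ≤ s) (lam : ℂ) :
    higgsIdeal (jordan i m lam) = ⨅ v, componentIdeal i m v := by
  rw [higgsIdeal_eq_iInf hs hi hipos]
  exact iInf_congr fun v => (componentIdeal_eq hi hipos v).symm

include hi hipos in
lemma radical_componentIdeal (v : Fin s) : (componentIdeal i m v).radical =
    shiftIdeal blk pos (Subtype.val_injective (p := fun b : Blk m => b.1 ≤ v)) 1 := by
  rw [componentIdeal_eq hi hipos, radical_shiftIdeal _ _ _ (hipos v).ne']

include hi hipos hm in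
lemma strictAnti_radical_componentIdeal :
    StrictAnti (fun v => (componentIdeal i m v).radical) := by
  intro v v' h
  dsimp only
  rw [radical_componentIdeal hi hipos, radical_componentIdeal hi hipos]
  refine SetLike.lt_iff_le_and_exists.mpr ⟨fun f hf => ?_,
    MvPolynomial.X ⟨v', ⟨0, hm v'⟩, ⟨0, hipos v'⟩⟩, ?_, ?_⟩
  · rw [mem_shiftIdeal] at hf ⊢
    simp only [Subtype.range_coe_subtype, Set.mem_ofPred_eq] at hf ⊢
    exact fun α hα => hf α fun b hb => (hα b hb).trans h.le
  · exact X_mem_shiftIdeal_of_notMem _ _ _ (by simpa [blk] using h)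
  · exact X_notMem_shiftIdeal _ _ _ Nat.zero_lt_one (by simp [blk])

include hi hipos hm in
lemma injective_componentIdeal : Function.Injective (componentIdeal i m) :=
  fun _ _ h => (strictAnti_radical_componentIdeal hi hipos hm).injective
    (congrArg Ideal.radical h)

open Classical in
include hi hipos hm in
/-- The last coordinate of a block of size `i v` lies in all the components but `componentIdeal v`:
the blocks are truncated earlier in the later components, and absent from the earlier ones. -/
lemma isMinimalPrimaryDecomposition_componentIdeal (hs : 1 ≤ s) (lam : ℂ) :
    Submodule.IsMinimalPrimaryDecomposition (higgsIdeal (jordan i m lam))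
      (Finset.univ.image (componentIdeal i m)) where
  inf_eq := by
    rw [higgsIdeal_eq_iInf_componentIdeal hi hipos hs, Finset.inf_image,
      Finset.inf_univ_eq_iInf]
    rfl
  primary J hJ := by
    obtain ⟨v, -, rfl⟩ := Finset.mem_image.mp hJ
    rw [componentIdeal_eq hi hipos]
    exact isPrimary_shiftIdeal _ _ _ (hipos v).ne'
  distinct J hJ J' hJ' h := by
    obtain ⟨v, -, rfl⟩ := Finset.mem_image.mp hJ
    obtain ⟨v', -, rfl⟩ := Finset.mem_image.mp hJ'
    simp only [Function.onFun, Submodule.colon_univ]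
    exact (strictAnti_radical_componentIdeal hi hipos hm).injective.ne
      fun h' => h (congrArg _ h')
  minimal J hJ h := by
    obtain ⟨v, -, rfl⟩ := Finset.mem_image.mp hJ
    let p : Idx i m := ⟨v, ⟨0, hm v⟩, ⟨i v - 1, Nat.sub_lt (hipos v) Nat.one_pos⟩⟩
    have h1 : (MvPolynomial.X p : MvPolynomial (Idx i m) ℂ) ∉ componentIdeal i m v := by
      rw [componentIdeal_eq hi hipos]
      exact X_notMem_shiftIdeal _ _ _ (Nat.sub_lt (hipos v) Nat.one_pos) (by simp [blk, p])
    refine h1 (h ?_)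
    rw [Submodule.mem_finsetInf]
    intro J' hJ'
    obtain ⟨hne, hJ'⟩ := Finset.mem_erase.mp hJ'
    obtain ⟨v', -, rfl⟩ := Finset.mem_image.mp hJ'
    rw [id, componentIdeal_eq hi hipos]
    rcases lt_trichotomy v v' with hv | rfl | hv
    · exact X_mem_shiftIdeal_of_le _ _ _ (Nat.le_sub_one_of_lt (hi hv))
    · exact (hne rfl).elim
    · exact X_mem_shiftIdeal_of_notMem _ _ _ (by simpa [blk, p] using hv)

end PrimaryDecomposition

/-! ### The homogeneous ideal of the Higgs Grassmannian -/

section HiggsIdeal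

variable {n : Type} [Fintype n] {R : Type} [CommRing R]

lemma isHomogeneous_higgsIdeal (φ : Matrix n n R) :
    (higgsIdeal φ).IsHomogeneous (grading n R) := by
  refine Ideal.homogeneous_span _ _ ?_
  rintro _ ⟨p, rfl⟩
  refine ⟨2, MvPolynomial.IsHomogeneous.sum _ _ _ fun k _ => ?_⟩
  refine (MvPolynomial.isHomogeneous_X R k).mul (n := 1) (MvPolynomial.IsHomogeneous.sub ?_ ?_) <;>
  exact (MvPolynomial.isHomogeneous_C _ _).mul (m := 0) (MvPolynomial.isHomogeneous_X R _)

open Classical in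
/-- On a chart, the linear forms vanishing on `e = (z_k / z_a)_k` are spanned by the
`e_p μ_q - e_q μ_p`, for `μ_p` the coordinate forms. -/
lemma higgsChartIdeal_eq (φ : Matrix n n R) (a : n) :
    higgsChartIdeal φ a = (higgsIdeal φ).map (dehom a) := by
  let w : n → ChartRing n R a := fun k => ∑ l, const a (φ k l) * coord a l
  have hgen : ∀ p : n × n, dehom a (∑ k, MvPolynomial.X k * (MvPolynomial.C (φ p.2 k) *
      MvPolynomial.X p.1 - MvPolynomial.C (φ p.1 k) * MvPolynomial.X p.2)) =
      coord a p.1 * w p.2 - coord a p.2 * w p.1 := fun p => by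
    simp only [map_sum, map_mul, map_sub, dehom_X, dehom_C, w, Finset.mul_sum,
      ← Finset.sum_sub_distrib]
    exact Finset.sum_congr rfl fun k _ => by ring
  rw [higgsIdeal, Ideal.map_span, ← Set.range_comp]
  refine le_antisymm ?_ ?_ <;> refine Ideal.span_le.mpr ?_
  · rintro _ ⟨μ, hμ, rfl⟩
    have h : ∑ k, μ k * w k = ∑ k, μ k * (coord a a * w k - coord a k * w a) := by
      simp only [mul_sub, Finset.sum_sub_distrib, ← mul_assoc, ← Finset.sum_mul, hμ, coord_self]
      simp
    change ∑ k, μ k * w k ∈ _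
    rw [h]
    refine Ideal.sum_mem _ fun k _ => Ideal.mul_mem_left _ _ (Ideal.subset_span ⟨(a, k), ?_⟩)
    exact hgen (a, k)
  · rintro _ ⟨p, rfl⟩
    rw [Function.comp_apply, hgen]
    refine Ideal.subset_span ⟨fun k =>
      Pi.single (M := fun _ => ChartRing n R a) p.2 (coord a p.1) k -
      Pi.single (M := fun _ => ChartRing n R a) p.1 (coord a p.2) k, ?_, ?_⟩
    · simp [sub_mul, Finset.sum_sub_distrib, Pi.single_apply, mul_comm (coord a p.1)]
    · simp [sub_mul, Finset.sum_sub_distrib, Pi.single_apply, w]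

lemma higgsSheaf_eq_idealSheaf (φ : Matrix n n R) : higgsSheaf φ = idealSheaf (higgsIdeal φ) := by
  rw [higgsSheaf, idealSheaf]
  congr 1
  funext a
  rw [higgsChartIdeal_eq, comap_map_eq_map_dehom a (isHomogeneous_higgsIdeal φ)]

lemma map_higgsIdeal {S : Type} [CommRing S] (f : R →+* S) (φ : Matrix n n R) :
    (higgsIdeal φ).map (MvPolynomial.map f) = higgsIdeal (φ.map f) := by
  rw [higgsIdeal, Ideal.map_span, ← Set.range_comp, higgsIdeal]
  congr 2
  funext p
  simp

end HiggsIdeal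

lemma jordan_map {s : ℕ} (i m : Fin s → ℕ) {R S : Type} [CommRing R] [CommRing S] (f : R →+* S)
    (lam : R) : (jordan i m lam).map f = jordan i m (f lam) := by
  ext p q
  simp only [Matrix.map_apply, jordan]
  split_ifs <;> simp

/-! ### The fibres of the Higgs Grassmannian -/

section HgrassFibre

variable {n : Type} [Fintype n] {R S : Type} [CommRing R] [CommRing S]

instance (φ : Matrix n n R) : IsClosedImmersion (Hgrass.ι φ) :=
  inferInstanceAs (IsClosedImmersion (higgsSheaf φ).subschemeι)

lemma ker_Hgrass_ι (φ : Matrix n n R) : (Hgrass.ι φ).ker = idealSheaf (higgsIdeal φ) :=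
  (higgsSheaf φ).ker_subschemeι.trans (higgsSheaf_eq_idealSheaf φ)

/-- The base change of the Higgs Grassmannian along `Spec S ⟶ Spec R` is the closed subscheme of
`ℙ(S^n)` defined by the quadrics with the coefficients mapped to `S`. -/
lemma exists_baseChange_Hgrass (φ : Matrix n n R) (f : R →+* S) :
    ∃ j : pullback (Hgrass.ρ φ) (Spec.map (CommRingCat.ofHom f)) ⟶ PP n S,
      IsClosedImmersion j ∧
      j ≫ PP.map n f = pullback.fst (Hgrass.ρ φ) (Spec.map (CommRingCat.ofHom f)) ≫ Hgrass.ι φ ∧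
      j ≫ PP.toSpec n S = pullback.snd (Hgrass.ρ φ) (Spec.map (CommRingCat.ofHom f)) ∧
      j.ker = idealSheaf (higgsIdeal (φ.map f)) := by
  have H := isPullback_PP_map (n := n) f
  have H' := IsPullback.of_hasPullback (Hgrass.ρ φ) (Spec.map (CommRingCat.ofHom f))
  let j := H.lift (pullback.fst (Hgrass.ρ φ) (Spec.map (CommRingCat.ofHom f)) ≫ Hgrass.ι φ)
    (pullback.snd (Hgrass.ρ φ) (Spec.map (CommRingCat.ofHom f))) (by
      rw [Category.assoc]; exact pullback.condition)
  have h1 : j ≫ PP.map n f = _ := H.lift_fst ..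
  have h2 : j ≫ PP.toSpec n S = _ := H.lift_snd ..
  have hj : IsPullback j (pullback.fst (Hgrass.ρ φ) (Spec.map (CommRingCat.ofHom f)))
      (PP.map n f) (Hgrass.ι φ) := by
    refine IsPullback.of_right (h₁₂ := PP.toSpec n S) (h₂₂ := PP.toSpec n R) ?_ h1 H.flip
    rw [h2]
    exact H'.flip
  refine ⟨j, MorphismProperty.of_isPullback hj.flip inferInstance, h1, h2, ?_⟩
  rw [← hj.isoPullback_hom_fst, Scheme.Hom.ker_comp_of_isIso,
    Scheme.IdealSheafData.ker_fst_of_isClosedImmersion,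
    ker_Hgrass_ι, comap_idealSheaf_map f (isHomogeneous_higgsIdeal φ), map_higgsIdeal]

end HgrassFibre

/-! ### Projective space over a fat point as a component -/

/-- The morphism of projective spectra of a graded homomorphism that is `f` on constants lies over
`Spec f`. -/
lemma Proj_map_toSpec {n n' R S : Type} [CommRing R] [CommRing S]
    (φ : GradedRingHom (grading n R) (grading n' S))
    (hφ : HomogeneousIdeal.irrelevant (grading n' S) ≤
      (HomogeneousIdeal.irrelevant (grading n R)).map φ)
    (h : ∀ k, ∃ j, φ (MvPolynomial.X j) = MvPolynomial.X k) (f : R →+* S)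
    (hf : ∀ r, φ (MvPolynomial.C r) = MvPolynomial.C (f r)) :
    Proj.map φ hφ ≫ PP.toSpec n R = PP.toSpec n' S ≫ Spec.map (CommRingCat.ofHom f) := by
  refine (chartCover n' S).openCover.hom_ext _ _ fun (k : n') => ?_
  change chart k ≫ _ = chart k ≫ _
  obtain ⟨a, ha⟩ := h k
  obtain ⟨ρ, h1, h2⟩ := exists_isPullback_awayι φ hφ a (MvPolynomial.X k) ha (X_mem k)
  have h3 : ρ.comp (const a) = (const k).comp f := by
    ext r : 1
    have h4 := h1 0 (MvPolynomial.C r) (MvPolynomial.isHomogeneous_C n r)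
    rw [dehom_C] at h4
    rw [RingHom.comp_apply, h4, away_mk_eq_dehom, hf, dehom_C, RingHom.comp_apply]
  rw [← Category.assoc, ← Category.assoc, chart_toSpec, ← Spec.map_comp, ← CommRingCat.ofHom_comp,
    ← h3, CommRingCat.ofHom_comp, Spec.map_comp, ← chart_toSpec, ← Category.assoc]
  exact congrArg (· ≫ PP.toSpec n R) h2.w.symm

section Truncation

variable {s : ℕ} {i m : Fin s → ℕ} {N : Type} {inj : N → Blk m} (hinj : Function.Injective inj)
  (l : ℕ)

/-- The coordinate ring `ℂ[t]/(t^l)` of the fat point. -/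
abbrev Trunc (l : ℕ) : Type := Polynomial ℂ ⧸ Ideal.span {(Polynomial.X : Polynomial ℂ) ^ l}

/-- The reduction of `blockHom` modulo `t ^ l`. -/
def truncHom : MvPolynomial (Idx i m) ℂ →+* MvPolynomial N (Trunc l) :=
  (MvPolynomial.map (Ideal.Quotient.mk _)).comp (blockHom blk pos hinj)

lemma ker_truncHom : RingHom.ker (truncHom (i := i) hinj l) = shiftIdeal blk pos hinj l := by
  rw [truncHom, ← RingHom.comap_ker, MvPolynomial.ker_map, Ideal.mk_ker, Ideal.map_span,
    Set.image_singleton, shiftIdeal]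

lemma truncHom_C (c : ℂ) : truncHom (i := i) hinj l (MvPolynomial.C c) =
    MvPolynomial.C (algebraMap ℂ (Trunc l) c) := by
  rw [truncHom, RingHom.comp_apply, blockHom_C, MvPolynomial.map_C]
  rfl

lemma truncHom_X (p : Idx i m) (a : N) (h : blk p = inj a) :
    truncHom hinj l (MvPolynomial.X p) =
      MvPolynomial.C (Ideal.Quotient.mk _ (Polynomial.X ^ pos p)) * MvPolynomial.X a := by
  rw [truncHom, RingHom.comp_apply, blockHom_X _ _ hinj p a h, map_mul, MvPolynomial.map_C,
    MvPolynomial.map_X]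

lemma mk_X_pow_eq_zero {l k : ℕ} (h : l ≤ k) : (Ideal.Quotient.mk (Ideal.span
    {(Polynomial.X : Polynomial ℂ) ^ l}) (Polynomial.X ^ k)) = 0 := by
  rw [Ideal.Quotient.eq_zero_iff_mem, Ideal.mem_span_singleton]
  exact pow_dvd_pow _ h

lemma truncHom_X_pow_eq_zero (hl : l ≠ 0) (p : Idx i m) (h : pos p ≠ 0 ∨ blk p ∉ Set.range inj) :
    truncHom hinj l (MvPolynomial.X p) ^ l = 0 := by
  by_cases hp : blk p ∈ Set.range inj
  · obtain ⟨a, ha⟩ := hp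
    rw [truncHom_X hinj l p a ha.symm, mul_pow, ← map_pow, ← map_pow, ← pow_mul,
      mk_X_pow_eq_zero, map_zero, zero_mul]
    exact Nat.le_mul_of_pos_left _ (Nat.pos_of_ne_zero (h.resolve_right (not_not.mpr ⟨a, ha⟩)))
  · rw [truncHom, RingHom.comp_apply, blockHom_X_eq_zero _ _ hinj p hp, map_zero, zero_pow hl]

/-- `truncHom` as a homomorphism of graded rings. -/
def truncGraded : GradedRingHom (grading (Idx i m) ℂ) (grading N (Trunc l)) where
  __ := truncHom hinj l
  map_mem {k f} hf := by
    have h : truncHom hinj l = MvPolynomial.eval₂Hom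
        ((truncHom (i := i) hinj l).comp MvPolynomial.C)
        (fun p : Idx i m => truncHom hinj l (MvPolynomial.X p)) := by ext p : 2 <;> simp
    change truncHom hinj l f ∈ _
    rw [h]
    refine one_mul k ▸ MvPolynomial.IsHomogeneous.eval₂ (n := 1) hf _ _ (fun r => ?_) fun p => ?_
    · rw [RingHom.comp_apply, truncHom_C]
      exact MvPolynomial.isHomogeneous_C _ _
    · by_cases hp : blk p ∈ Set.range inj
      · obtain ⟨a, ha⟩ := hp
        rw [truncHom_X hinj l p a ha.symm]
        exact (MvPolynomial.isHomogeneous_C _ _).mul (m := 0) (MvPolynomial.isHomogeneous_X _ _)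
      · rw [truncHom, RingHom.comp_apply, blockHom_X_eq_zero _ _ hinj p hp, map_zero]
        exact MvPolynomial.isHomogeneous_zero _ _ _

lemma truncGraded_apply (f : MvPolynomial (Idx i m) ℂ) :
    truncGraded hinj l f = truncHom hinj l f := rfl

variable {l} (hl : ∀ a, l ≤ i (inj a).1)

include hl in
/-- A coordinate `y_a` absorbs the coefficients: `t ^ k y_a` is the image of the coordinate at
position `k` of the block. -/
lemma exists_truncHom_eq_C_mul_X (a : N) (r : Trunc l) : ∃ q : MvPolynomial (Idx i m) ℂ,
    q.IsHomogeneous 1 ∧ truncHom hinj l q = MvPolynomial.C r * MvPolynomial.X a := by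
  obtain ⟨P, rfl⟩ := Ideal.Quotient.mk_surjective r
  induction P using Polynomial.induction_on' with
  | add P Q hP hQ =>
    obtain ⟨p, hp, hp'⟩ := hP
    obtain ⟨q, hq, hq'⟩ := hQ
    exact ⟨p + q, hp.add hq, by rw [map_add, hp', hq', map_add, map_add, add_mul]⟩
  | monomial k c =>
    by_cases hk : k < l
    · refine ⟨MvPolynomial.C c * MvPolynomial.X ⟨(inj a).1, (inj a).2, ⟨k, hk.trans_le (hl a)⟩⟩,
        (MvPolynomial.isHomogeneous_C _ _).mul (m := 0) (MvPolynomial.isHomogeneous_X _ _), ?_⟩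
      rw [map_mul, truncHom_C, truncHom_X hinj l _ a rfl, ← mul_assoc, ← map_mul,
        ← Polynomial.C_mul_X_pow_eq_monomial, map_mul (Ideal.Quotient.mk _)]
      rfl
    · refine ⟨0, MvPolynomial.isHomogeneous_zero _ _ _, ?_⟩
      rw [← Polynomial.C_mul_X_pow_eq_monomial, map_mul, mk_X_pow_eq_zero (not_lt.mp hk), mul_zero,
        map_zero, map_zero, zero_mul]

include hl in
lemma exists_truncHom_eq_X (hl0 : 0 < l) (a : N) :
    ∃ p : Idx i m, truncHom hinj l (MvPolynomial.X p) = MvPolynomial.X a := by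
  refine ⟨⟨(inj a).1, (inj a).2, ⟨0, hl0.trans_le (hl a)⟩⟩, ?_⟩
  rw [truncHom_X hinj l _ a rfl]
  simp [pos]

include hl in
/-- `truncHom` is onto after multiplication with a coordinate `y_a`: each monomial `r y ^ e` of `q`
is lifted by a lift of `r y_a` times lifts of the variables in `y ^ e`. -/
lemma exists_truncHom_eq_X_mul (hl0 : 0 < l) (a : N) {k : ℕ} {q : MvPolynomial N (Trunc l)}
    (hq : q.IsHomogeneous k) : ∃ p : MvPolynomial (Idx i m) ℂ,
      p.IsHomogeneous (1 + k) ∧ truncHom hinj l p = MvPolynomial.X a * q := by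
  choose u hu using exists_truncHom_eq_X (i := i) hinj hl hl0
  choose w hw hw' using exists_truncHom_eq_C_mul_X hinj hl a
  refine ⟨∑ e ∈ q.support, w (q.coeff e) * MvPolynomial.monomial (e.mapDomain u) 1,
    MvPolynomial.IsHomogeneous.sum _ _ _ fun e he => (hw _).mul ?_, ?_⟩
  · refine MvPolynomial.isHomogeneous_monomial _ ?_
    rw [Finsupp.degree_mapDomain, Finsupp.degree_eq_weight_one]
    exact hq (MvPolynomial.mem_support_iff.mp he)
  · conv_rhs => rw [q.as_sum, Finset.mul_sum]
    rw [map_sum]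
    refine Finset.sum_congr rfl fun e _ => ?_
    have h : truncHom hinj l (MvPolynomial.monomial (e.mapDomain u) 1) =
        MvPolynomial.monomial e 1 := by
      rw [MvPolynomial.monomial_eq, MvPolynomial.monomial_eq,
        Finsupp.prod_mapDomain_index (by simp) (fun _ _ _ => pow_add _ _ _)]
      simp [Finsupp.prod, hu]
    rw [map_mul, hw', h, mul_right_comm, MvPolynomial.C_mul_monomial, mul_one, mul_comm]

include hl in
lemma irrelevant_le_truncGraded (hl0 : 0 < l) :
    HomogeneousIdeal.irrelevant (grading N (Trunc l)) ≤
      (HomogeneousIdeal.irrelevant (grading (Idx i m) ℂ)).map (truncGraded hinj l) :=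
  irrelevant_le_of_X_mem N _ fun a => exists_truncHom_eq_X hinj hl hl0 a

/-- The morphism of `truncHom` from the projective space over the fat point with the coordinates
`y_a`, `a ∈ N`, to `ℙ^{r-1}`. -/
def truncMap (hl0 : 0 < l) : PP N (Trunc l) ⟶ PP (Idx i m) ℂ :=
  Proj.map (truncGraded hinj l) (irrelevant_le_truncGraded hinj hl hl0)

lemma truncMap_toSpec (hl0 : 0 < l) : truncMap hinj hl hl0 ≫ PP.toSpec (Idx i m) ℂ =
    PP.toSpec N (Trunc l) ≫ fatPoint.toSpec l :=
  Proj_map_toSpec _ _ (exists_truncHom_eq_X hinj hl hl0) _ (truncHom_C hinj l)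

lemma truncMap_isClosedImmersion_and_ker (hl0 : 0 < l) :
    IsClosedImmersion (truncMap hinj hl hl0) ∧
      (truncMap hinj hl hl0).ker = idealSheaf (shiftIdeal blk pos hinj l) := by
  rw [← ker_truncHom hinj l]
  refine isClosedImmersion_map_and_ker _ _ fun p k q hq => ?_
  simp only [truncGraded_apply]
  -- The images of the other coordinates than the first ones of the blocks are nilpotent.
  by_cases h : pos p ≠ 0 ∨ blk p ∉ Set.range inj
  · exact ⟨l, 0, MvPolynomial.isHomogeneous_zero _ _ _, by
      rw [truncHom_X_pow_eq_zero hinj l hl0.ne' p h, map_zero, zero_mul]⟩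
  · push Not at h
    obtain ⟨h0, a, ha⟩ := h
    obtain ⟨f, hf, hf'⟩ := exists_truncHom_eq_X_mul hinj hl hl0 a hq
    refine ⟨1, f, hf, ?_⟩
    rw [hf', pow_one, truncHom_X hinj l p a ha.symm, h0]
    simp

end Truncation

/-! ### The structure of the components -/

section Bundle

/-- A product with the fibre is a bundle, trivial over the whole base. -/
lemma isBundle_of_isPullback {V P F S : Scheme.{0}} {π : V ⟶ P} {σ : V ⟶ F} {p : P ⟶ S}
    {q : F ⟶ S} (H : IsPullback π σ p q) : IsBundle π p q := fun _ =>
  have H' := (isPullback_morphismRestrict π ⊤).paste_vert H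
  ⟨⊤, trivial, H'.isoPullback, H'.isoPullback_hom_fst⟩

/-- The closed point of the fat point, on functions. -/
def truncEval (l : ℕ) (hl : 0 < l) : Trunc l →+* ℂ :=
  Ideal.Quotient.lift _ (Polynomial.evalRingHom 0) fun f hf => by
    obtain ⟨g, rfl⟩ := Ideal.mem_span_singleton.mp hf
    simp [hl.ne']

variable {l : ℕ} (hl : 0 < l)

lemma truncEval_comp_algebraMap :
    (truncEval l hl).comp (algebraMap ℂ (Trunc l)) = RingHom.id ℂ := by
  ext c
  exact Polynomial.eval_C

lemma truncEval_surjective : Function.Surjective (truncEval l hl) := fun c =>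
  ⟨algebraMap ℂ _ c, RingHom.congr_fun (truncEval_comp_algebraMap hl) c⟩

lemma ker_truncEval_le : RingHom.ker (truncEval l hl) ≤ nilradical (Trunc l) := by
  intro f hf
  obtain ⟨P, rfl⟩ := Ideal.Quotient.mk_surjective f
  have hP : P.eval 0 = 0 := hf
  rw [← Polynomial.coeff_zero_eq_eval_zero, ← Polynomial.X_dvd_iff] at hP
  exact mem_nilradical.mpr ⟨l, by
    rw [← map_pow, Ideal.Quotient.eq_zero_iff_mem, Ideal.mem_span_singleton]
    exact pow_dvd_pow_of_dvd hP l⟩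

instance {n : Type} : IsClosedImmersion (PP.map n (truncEval l hl)) :=
  have := IsClosedImmersion.spec_of_surjective (CommRingCat.ofHom (truncEval l hl))
    (truncEval_surjective hl)
  MorphismProperty.of_isPullback (isPullback_PP_map (n := n) (truncEval l hl)).flip this

instance {n : Type} : Surjective (PP.map n (truncEval l hl)) := by
  have h : Surjective (Spec.map (CommRingCat.ofHom (truncEval l hl))) :=
    ⟨(PrimeSpectrum.isHomeomorph_comap (truncEval l hl)
      (fun x => ⟨1, one_pos, by simpa using truncEval_surjective hl x⟩)
      (ker_truncEval_le hl)).surjective⟩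
  exact MorphismProperty.of_isPullback (isPullback_PP_map (n := n) (truncEval l hl)).flip h

include hl in
/-- The structure of a closed subscheme of projective space that is isomorphic, over `ℂ`, to a
projective space over a fat point. -/
theorem structure_of_isClosedImmersion {n : Type} {d : ℕ} {I : Ideal (MvPolynomial n ℂ)}
    (F : PP (Fin (d + 1)) (Trunc l) ⟶ PP n ℂ) [IsClosedImmersion F] (hF : F.ker = idealSheaf I)
    (hS : F ≫ PP.toSpec n ℂ = PP.toSpec (Fin (d + 1)) (Trunc l) ≫ fatPoint.toSpec l) :
    IrreducibleSpace (zeroScheme I) ∧ topologicalKrullDim (zeroScheme I) = (d : WithBot ℕ∞) ∧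
    ∃ π : zeroScheme I ⟶ PP (Fin (d + 1)) ℂ,
      π ≫ PP.toSpec (Fin (d + 1)) ℂ = zeroScheme.toSpec I ∧
      IsIso ((zeroScheme I).nilradical.subschemeι ≫ π) ∧
      IsBundle π (PP.toSpec (Fin (d + 1)) ℂ) (fatPoint.toSpec l) := by
  have hF' : F.ker = (idealSheaf I).subschemeι.ker :=
    hF.trans (idealSheaf I).ker_subschemeι.symm
  let e := IsClosedImmersion.lift F (idealSheaf I).subschemeι hF'.le
  have : IsIso e := IsClosedImmersion.isIso_lift F (idealSheaf I).subschemeι hF'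
  have he : e ≫ F = (idealSheaf I).subschemeι := IsClosedImmersion.lift_fac ..
  -- The section `t = 0` of the projection `π`.
  let r : PP (Fin (d + 1)) ℂ ⟶ zeroScheme I := PP.map _ (truncEval l hl) ≫ inv e
  let π : zeroScheme I ⟶ PP (Fin (d + 1)) ℂ := e ≫ PP.map _ (algebraMap ℂ (Trunc l))
  have hr : r ≫ π = 𝟙 _ := by
    rw [Category.assoc, IsIso.inv_hom_id_assoc, ← PP.map_comp, truncEval_comp_algebraMap,
      PP.map_id]
  have hrh : IsHomeomorph r :=
    isHomeomorph_iff_isEmbedding_surjective.mpr ⟨r.isClosedEmbedding.isEmbedding, r.surjective⟩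
  have H := isPullback_PP_map (n := Fin (d + 1)) (algebraMap ℂ (Trunc l))
  refine ⟨r.surjective.irreducibleSpace r.continuous,
    hrh.topologicalKrullDim_eq.symm.trans (topologicalKrullDim_PP ℂ d), π, ?_,
    isIso_nilradical_subschemeι_comp r π hr, ?_⟩
  · rw [zeroScheme.toSpec, ← he, Category.assoc, Category.assoc, H.w, hS]
    rfl
  · exact isBundle_of_isPullback (σ := e ≫ PP.toSpec (Fin (d + 1)) (Trunc l))
      (H.of_iso (asIso e).symm (Iso.refl _) (Iso.refl _) (Iso.refl _)
        (by simp [π]) (by simp) (by simp) (by simp; rfl))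

end Bundle

section Embedding

variable {s : ℕ} {m : Fin s → ℕ}

/-- The Jordan blocks of size at least `i v`, in terms of which `componentIdeal` is an ideal of
truncated shifts, are `d_v + 1` in number. -/
lemma exists_injective_range_iff (hm : ∀ v, 0 < m v) (v : Fin s) :
    ∃ inj : Fin (dd m v + 1) → Blk m, Function.Injective inj ∧
      ∀ b, b ∈ Set.range inj ↔ b.1 ≤ v := by
  classical
  have hpos : 0 < ∑ w ∈ Finset.Iic v, m w :=
    Finset.sum_pos (fun w _ => hm w) ⟨v, Finset.mem_Iic.mpr le_rfl⟩
  have hcard : Fintype.card {b : Blk m // b.1 ≤ v} = dd m v + 1 := by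
    rw [dd, Nat.sub_add_cancel hpos, Fintype.card_subtype]
    have : (Finset.univ.filter fun b : Blk m => b.1 ≤ v) =
        (Finset.Iic v).sigma fun _ => Finset.univ := by
      ext b; simp
    rw [this, Finset.card_sigma]
    simp
  let e := (Fintype.equivFinOfCardEq hcard).symm
  refine ⟨fun a => (e a).1, Subtype.val_injective.comp e.injective, fun b => ⟨?_, fun hb => ?_⟩⟩
  · rintro ⟨a, rfl⟩
    exact (e a).2
  · exact ⟨e.symm ⟨b, hb⟩, by simp⟩

end Embedding

theorem structure_component {s : ℕ} {i m : Fin s → ℕ} (hi : StrictAnti i) (hipos : ∀ v, 0 < i v)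
    (hm : ∀ v, 0 < m v) (v : Fin s) : IrreducibleSpace (component i m v) ∧
    topologicalKrullDim (component i m v) = (dd m v : WithBot ℕ∞) ∧
    ∃ π : component i m v ⟶ PP (Fin (dd m v + 1)) ℂ,
      π ≫ PP.toSpec (Fin (dd m v + 1)) ℂ = zeroScheme.toSpec (componentIdeal i m v) ∧
      IsIso ((component i m v).nilradical.subschemeι ≫ π) ∧
      IsBundle π (PP.toSpec (Fin (dd m v + 1)) ℂ) (fatPoint.toSpec (i v)) := by
  obtain ⟨inj, hinj, hr⟩ := exists_injective_range_iff hm v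
  have hl : ∀ a, i v ≤ i (inj a).1 := fun a => hi.antitone ((hr _).mp ⟨a, rfl⟩)
  obtain ⟨h1, h2⟩ := truncMap_isClosedImmersion_and_ker hinj hl (hipos v)
  rw [← componentIdeal_eq_shiftIdeal hinj hr hi (hipos v)] at h2
  exact structure_of_isClosedImmersion (hipos v) (truncMap hinj hl (hipos v)) h2
    (truncMap_toSpec hinj hl (hipos v))

end HiggsGrass

end

open HiggsGrass in
open Classical in
theorem mainTheorem2 (s : ℕ) (hs : 1 ≤ s) (i m : Fin s → ℕ) (hi : StrictAnti i)
    (hipos : ∀ v, 0 < i v) (hm : ∀ v, 0 < m v) (lam : Polynomial ℂ) (b : ℂ) :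
    -- the fibre over `x = b` as a closed subscheme of `ℙ(E_b)`, and its homogeneous ideal
    (∃ j : pullback (Hgrass.ρ (jordan i m lam)) (pt b) ⟶ PP (Idx i m) ℂ,
      IsClosedImmersion j ∧
      j ≫ fibreIncl (Idx i m) b =
        pullback.fst (Hgrass.ρ (jordan i m lam)) (pt b) ≫ Hgrass.ι (jordan i m lam) ∧
      j ≫ PP.toSpec (Idx i m) ℂ = pullback.snd (Hgrass.ρ (jordan i m lam)) (pt b) ∧
      j.ker = idealSheaf (higgsIdeal (jordan i m (lam.eval b))) ∧
      -- the fibre is the scheme-theoretic union of the components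
      j.ker = ⨅ v, idealSheaf (componentIdeal i m v)) ∧
    -- the primary decomposition, with `s` distinct primary components
    Function.Injective (componentIdeal i m) ∧
    Submodule.IsMinimalPrimaryDecomposition (higgsIdeal (jordan i m (lam.eval b)))
      (Finset.univ.image (componentIdeal i m)) ∧
    -- the components are irreducible and embedded in one another topologically
    (∀ v, IrreducibleSpace (component i m v)) ∧
    StrictAnti (fun v => (componentIdeal i m v).radical) ∧
    -- the structure of the components
    ∀ v,
      topologicalKrullDim (component i m v) = (dd m v : WithBot ℕ∞) ∧
      ∃ π : component i m v ⟶ PP (Fin (dd m v + 1)) ℂ,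
        π ≫ PP.toSpec (Fin (dd m v + 1)) ℂ = zeroScheme.toSpec (componentIdeal i m v) ∧
        -- `π` identifies the reduction of the component with the projective space
        IsIso ((component i m v).nilradical.subschemeι ≫ π) ∧
        -- `π` is a bundle with fibre a fat point
        IsBundle π (PP.toSpec (Fin (dd m v + 1)) ℂ) (fatPoint.toSpec (i v)) := by
  refine ⟨?_, injective_componentIdeal hi hipos hm, ?_,
    fun v => (structure_component hi hipos hm v).1,
    strictAnti_radical_componentIdeal hi hipos hm,
    fun v => (structure_component hi hipos hm v).2⟩
  · obtain ⟨j, h1, h2, h3, h4⟩ :=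
      exists_baseChange_Hgrass (jordan i m lam) (Polynomial.evalRingHom b)
    rw [jordan_map, Polynomial.coe_evalRingHom] at h4
    refine ⟨j, h1, h2, h3, h4, h4.trans ?_⟩
    rw [higgsIdeal_eq_iInf_componentIdeal hi hipos hs, idealSheaf_iInf]
  · convert isMinimalPrimaryDecomposition_componentIdeal hi hipos hm hs (lam.eval b)
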